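/- \textbf{Theorem (Myerson's mechanism is $3$-wise-robust).} Let $F_1,\dots,F_n$ be probability distributions on $[0,\infty)$, regular or irregular, possibly with atoms, such that $x\cdot\Pr_{v\sim F_i}[v\ge x]\to 0$ as $x\to\infty$ for every $i$ (for instance, with finite means). For each $i$, the revenue curve of $F_i$ consists of the points $\bigl(\Pr_{v\sim F_i}[v\ge p],\,p\Pr_{v\sim F_i}[v\ge p]\bigr)$, $p\ge 0$, together with $(0,0)$. Let $\bar R_i:[0,1]\to\mathbb R$ be its least concave majorant, and let the ironed virtual value $\bar\varphi_i(x)$ be the right-hand derivative of $\bar R_i$ at $\Pr_{v\sim F_i}[v>x]$ (and $-\infty$ if this probability is $1$). For a priority order of the bidders, Myerson's mechanism allocates the item to the bidder with the highest nonnegative ironed virtual value $\bar\varphi_i(v_i)$ (to nobody, if all of them are negative), breaks ties in favour of the bidder who comes first in the order, and charges the winner the threshold bid, i.e. the infimum of the bids in $[0,\infty)$ with which she would still win. A randomized tie-breaking rule is a probability distribution $w$ on priority orders; the order is drawn from $w$ independently of the values. Write $\mathsf{Myer}_w(\boldsymbol F)$ for the expected revenue of the resulting mechanism (virtual values always computed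 from the marginals $F_1,\dots,F_n$) when the values are drawn from the joint prior $\boldsymbol F$. Then there is a randomized tie-breaking rule $w$, depending only on $F_1,\dots,F_n$, such that for every joint prior $\boldsymbol F$ on $\mathbb R^n$ with marginals $F_1,\dots,F_n$ under which the values of any at most three bidders are mutually independent, $$64\cdot \mathsf{Myer}_w(\boldsymbol F)\;\ge\;\mathsf{Myer}_w\Bigl(\prod_{i=1}^n F_i\Bigr).$$ -/

import Mathlib

open MeasureTheory ProbabilityTheory Set Filter Topology
open scoped ENNReal

noncomputable section

/-- The points `(P(v ≥ p), p · P(v ≥ p))` of the revenue curve of a value distribution `μ`: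
posting the price `p ≥ 0` sells with probability `P(v ≥ p)` and earns `p · P(v ≥ p)`.
The point `(0, 0)` stands for never selling. -/
def revenuePoints (μ : Measure ℝ) : Set (ℝ × ℝ) :=
  insert (0, 0) ((fun p : ℝ => (μ.real (Ici p), p * μ.real (Ici p))) '' Ici 0)

/-- The ironed revenue curve on `[0, 1]`: the least concave majorant of the revenue curve, i.e.
the largest revenue obtained by randomizing over prices with selling probability `q`. -/
def ironedRevenue (μ : Measure ℝ) (q : ℝ) : ℝ :=
  sSup {y : ℝ | (q, y) ∈ convexHull ℝ (revenuePoints μ)}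

/-- The ironed virtual value of the value `x`: the right-hand slope of the ironed revenue curve at
the quantile `P(v > x)`. (The quantiles of the value `x` fill `[P(v > x), P(v ≥ x)]`, and the
ironed revenue curve is affine there.) It is `-∞` at values below the support, where
`P(v > x) = 1`. For a regular distribution with density `f` this is `x - (1 - F x) / f x`. -/
def ironedVirtualValue (μ : Measure ℝ) (x : ℝ) : EReal :=
  if μ.real (Ioi x) < 1 then
    ((derivWithin (ironedRevenue μ) (Ioi (μ.real (Ioi x))) (μ.real (Ioi x)) : ℝ) : EReal)
  else ⊥

/-- Bidder `i` wins Myerson's mechanism for the marginals `F` at the bids `b`: her ironed virtual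
value is nonnegative and highest; ties go to the bidder that comes first in the order `σ`. -/
def MyersonWins {n : ℕ} (F : Fin n → Measure ℝ) (σ : Equiv.Perm (Fin n)) (b : Fin n → ℝ)
    (i : Fin n) : Prop :=
  0 ≤ ironedVirtualValue (F i) (b i) ∧
    ∀ j, j ≠ i →
      ironedVirtualValue (F j) (b j) < ironedVirtualValue (F i) (b i) ∨
        (ironedVirtualValue (F j) (b j) = ironedVirtualValue (F i) (b i) ∧ σ i < σ j)

open Classical in
/-- The winner pays her threshold bid: the infimum of the bids with which she would still win
against the others' bids. The losers pay nothing. -/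
def myersonPayment {n : ℕ} (F : Fin n → Measure ℝ) (σ : Equiv.Perm (Fin n)) (b : Fin n → ℝ)
    (i : Fin n) : ℝ :=
  if MyersonWins F σ b i then sInf {t : ℝ | 0 ≤ t ∧ MyersonWins F σ (Function.update b i t) i}
  else 0

/-- The expected revenue on the prior `P` of Myerson's mechanism for the marginals `F` with
randomized tie-breaking: a priority order is drawn from `w`, independently of the values. -/
def myersonRevenue {n : ℕ} (F : Fin n → Measure ℝ) (w : PMF (Equiv.Perm (Fin n)))
    (P : Measure (Fin n → ℝ)) : ℝ≥0∞ :=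
  ∑ σ : Equiv.Perm (Fin n),
    w σ * ∫⁻ v, ENNReal.ofReal (∑ i, myersonPayment F σ v i) ∂P

/-- `P` is a `k`-wise independent joint prior with marginals `F`: the values of any at most `k`
bidders are mutually independent under `P`. -/
structure IsKWiseIndependentPrior {n : ℕ} (k : ℕ) (F : Fin n → Measure ℝ)
    (P : Measure (Fin n → ℝ)) : Prop where
  isProbabilityMeasure : IsProbabilityMeasure P
  map_eval : ∀ i, P.map (fun v => v i) = F i
  iIndepFun : ∀ s : Finset (Fin n), s.card ≤ k →
    iIndepFun (fun (i : s) (v : Fin n → ℝ) => v i) P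

/-- A mechanism, given by its expected revenue on every prior, is `k`-wise-robust with constant `c`
for the marginals `F`. -/
def IsKWiseRobust {n : ℕ} (k : ℕ) (c : ℝ≥0∞) (F : Fin n → Measure ℝ)
    (rev : Measure (Fin n → ℝ) → ℝ≥0∞) : Prop :=
  ∀ P : Measure (Fin n → ℝ), IsKWiseIndependentPrior k F P → rev (Measure.pi F) ≤ c * rev P

end

/-! Any fixed priority order works; the identity is taken. Write R_i for the ironed revenue curve of
bidder i. A cut is a level T ≥ 0 of ironed virtual values, refined at ties by weights that follow
the priority order. If bidder i passes it with probability q_i, then T is a supporting slope of R_i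
at q_i, for all i at once (`ironedRevenue_le_cut`).

Upper bound: a winner whose winning bids have probability m > 0 pays at most R_i(m) / m. Hence the
revenue on the product prior is at most the ex-ante relaxation, and so at most ∑ R_i(q_i) + T (1 - ∑
q_i) (`lintegral_sum_myersonPayment_le`).

Lower bound: take a strict cut of total rate 1/3, with quantiles q_i, and a lax cut of total rate
2/3. If j passes the lax cut but not the strict one, then i beats j with probability at least q_i.
The threshold for beating j, times that probability, is a value of R_i, and it is at least R_i(q_i)
because R_i does not decrease while virtual values are nonnegative. So the pair (i, j) contributes
R_i(q_i) · P(j lies between the cuts), unless some third bidder interferes. Interference is paid for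
by the factor 1 - ∑ₖ [k passes the lax cut]. It is affine in the third bidders, so after expansion
every term involves at most three values and 3-wise independence determines its expectation.
Pointwise, these terms and a reserve price term for i passing alone add up to at most the true
payment of i; for a loser they are nonpositive (`sum_pairPayment_le_myersonPayment`).

In total the upper bound is at most 3 ∑ R_i(q_i) and the lower one at least (1/9) ∑ R_i(q_i), which
leaves room below 64. If virtual values are nonnegative at total rate below 2/3, the cut at level 0
and the reserve terms alone suffice. -/

/-! ### The ironed revenue curve and its right-hand slopes -/

section Revenue

variable {μ : Measure ℝ}

lemma zero_mem_revenuePoints : (0, 0) ∈ revenuePoints μ := mem_insert _ _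

lemma price_mem_revenuePoints {p : ℝ} (hp : 0 ≤ p) :
    (μ.real (Ici p), p * μ.real (Ici p)) ∈ revenuePoints μ :=
  mem_insert_of_mem _ ⟨p, hp, rfl⟩

lemma forall_mem_revenuePoints {C : ℝ × ℝ → Prop} (h0 : C (0, 0))
    (h : ∀ p : ℝ, 0 ≤ p → C (μ.real (Ici p), p * μ.real (Ici p))) :
    ∀ z ∈ revenuePoints μ, C z := by
  rintro z (rfl | ⟨p, hp, rfl⟩)
  · exact h0
  · exact h p hp

lemma convexHull_revenuePoints_le {s h : ℝ} (H : ∀ z ∈ revenuePoints μ, z.2 ≤ s * z.1 + h) :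
    ∀ z ∈ convexHull ℝ (revenuePoints μ), z.2 ≤ s * z.1 + h := by
  refine convexHull_min (t := {z : ℝ × ℝ | z.2 ≤ s * z.1 + h}) H ?_
  intro x hx y hy a b ha hb hab
  simp only [mem_ofPred_eq, Prod.snd_add, Prod.smul_snd, Prod.fst_add, Prod.smul_fst,
    smul_eq_mul] at *
  have hb' : b = 1 - a := by linarith
  subst hb'
  nlinarith

lemma ironedVirtualValue_of_lt {x : ℝ} (hx : μ.real (Ioi x) < 1) :
    ironedVirtualValue μ x =
      ((derivWithin (ironedRevenue μ) (Ioi (μ.real (Ioi x))) (μ.real (Ioi x)) : ℝ) : EReal) :=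
  if_pos hx

lemma ironedVirtualValue_lt_top (x : ℝ) : ironedVirtualValue μ x < ⊤ := by
  unfold ironedVirtualValue
  split_ifs
  · exact EReal.coe_lt_top _
  · exact bot_lt_top

variable [IsProbabilityMeasure μ]

lemma exists_revenuePoints_le (ht : Tendsto (fun x : ℝ => x * μ.real (Ici x)) atTop (𝓝 0)) :
    ∃ B : ℝ, ∀ z ∈ revenuePoints μ, z.2 ≤ B := by
  obtain ⟨N, hN⟩ := eventually_atTop.1 (ht.eventually_le_const zero_lt_one)
  refine ⟨max N 1, forall_mem_revenuePoints (by simp) fun p hp => ?_⟩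
  rcases le_total N p with h | h
  · exact (hN p h).trans (le_max_right _ _)
  · have : p * μ.real (Ici p) ≤ p * 1 := mul_le_mul_of_nonneg_left measureReal_le_one hp
    exact (this.trans (by linarith)).trans (le_max_left _ _)

lemma bddAbove_section_convexHull_revenuePoints
    (ht : Tendsto (fun x : ℝ => x * μ.real (Ici x)) atTop (𝓝 0)) (q : ℝ) :
    BddAbove {y : ℝ | (q, y) ∈ convexHull ℝ (revenuePoints μ)} := by
  obtain ⟨B, hB⟩ := exists_revenuePoints_le ht
  refine ⟨B, fun y hy => ?_⟩
  simpa using convexHull_revenuePoints_le (s := 0) (h := B) (by simpa using hB) _ hy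

lemma le_ironedRevenue (ht : Tendsto (fun x : ℝ => x * μ.real (Ici x)) atTop (𝓝 0)) {q y : ℝ}
    (h : (q, y) ∈ convexHull ℝ (revenuePoints μ)) : y ≤ ironedRevenue μ q :=
  le_csSup (bddAbove_section_convexHull_revenuePoints ht q) h

lemma price_le_ironedRevenue (ht : Tendsto (fun x : ℝ => x * μ.real (Ici x)) atTop (𝓝 0)) {p : ℝ}
    (hp : 0 ≤ p) : p * μ.real (Ici p) ≤ ironedRevenue μ (μ.real (Ici p)) :=
  le_ironedRevenue ht (subset_convexHull ℝ _ (price_mem_revenuePoints hp))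

lemma measureReal_Ici_zero (hnn : ∀ᵐ x ∂μ, 0 ≤ x) : μ.real (Ici 0) = 1 := by
  have h : μ (Ici (0 : ℝ))ᶜ = 0 := mem_ae_iff.1 (by filter_upwards [hnn] with x hx using hx)
  rw [measureReal_def, (prob_compl_eq_zero_iff measurableSet_Ici).1 h]
  rfl

lemma mk_zero_mem_convexHull_revenuePoints (hnn : ∀ᵐ x ∂μ, 0 ≤ x) {q : ℝ} (hq : q ∈ Icc (0 : ℝ) 1) :
    (q, 0) ∈ convexHull ℝ (revenuePoints μ) := by
  have h1 : ((1 : ℝ), (0 : ℝ)) ∈ revenuePoints μ := by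
    have := price_mem_revenuePoints (μ := μ) le_rfl
    rwa [measureReal_Ici_zero hnn, zero_mul] at this
  have := (convex_convexHull ℝ (revenuePoints μ)) (subset_convexHull ℝ _ zero_mem_revenuePoints)
    (subset_convexHull ℝ _ h1) (sub_nonneg.2 hq.2) hq.1 (by ring)
  simpa using this

lemma ironedRevenue_nonneg (hnn : ∀ᵐ x ∂μ, 0 ≤ x)
    (ht : Tendsto (fun x : ℝ => x * μ.real (Ici x)) atTop (𝓝 0)) {q : ℝ} (hq : q ∈ Icc (0 : ℝ) 1) :
    0 ≤ ironedRevenue μ q :=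
  le_ironedRevenue ht (mk_zero_mem_convexHull_revenuePoints hnn hq)

lemma ironedRevenue_le (hnn : ∀ᵐ x ∂μ, 0 ≤ x) {s h : ℝ}
    (H : ∀ z ∈ revenuePoints μ, z.2 ≤ s * z.1 + h) {q : ℝ} (hq : q ∈ Icc (0 : ℝ) 1) :
    ironedRevenue μ q ≤ s * q + h :=
  csSup_le ⟨0, mk_zero_mem_convexHull_revenuePoints hnn hq⟩ fun _ hy =>
    convexHull_revenuePoints_le H _ hy

/-- A convex combination with first coordinate 0 only charges points with first coordinate 0, and a
price that never sells earns 0. -/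
lemma ironedRevenue_zero (hnn : ∀ᵐ x ∂μ, 0 ≤ x)
    (ht : Tendsto (fun x : ℝ => x * μ.real (Ici x)) atTop (𝓝 0)) : ironedRevenue μ 0 = 0 := by
  refine le_antisymm ?_ (ironedRevenue_nonneg hnn ht (by simp))
  refine csSup_le ⟨0, mk_zero_mem_convexHull_revenuePoints hnn (by simp)⟩ fun y hy => ?_
  have key : convexHull ℝ (revenuePoints μ) ⊆ {z : ℝ × ℝ | 0 ≤ z.1 ∧ (z.1 = 0 → z.2 ≤ 0)} := by
    refine convexHull_min (forall_mem_revenuePoints (by simp) fun p hp => ⟨measureReal_nonneg,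
      fun h => by simp only at h; simp [h]⟩) ?_
    rintro x ⟨hx1, hx2⟩ y ⟨hy1, hy2⟩ a b ha hb hab
    simp only [mem_ofPred_eq, Prod.snd_add, Prod.smul_snd, Prod.fst_add, Prod.smul_fst, smul_eq_mul]
    have h1 := mul_nonneg ha hx1
    have h2 := mul_nonneg hb hy1
    refine ⟨add_nonneg h1 h2, fun h => ?_⟩
    have h3 : a * x.1 = 0 := by linarith
    have h4 : b * y.1 = 0 := by linarith
    have h5 : a * x.2 ≤ 0 := by
      rcases mul_eq_zero.1 h3 with h | h
      · simp [h]
      · exact mul_nonpos_of_nonneg_of_nonpos ha (hx2 h)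
    have h6 : b * y.2 ≤ 0 := by
      rcases mul_eq_zero.1 h4 with h | h
      · simp [h]
      · exact mul_nonpos_of_nonneg_of_nonpos hb (hy2 h)
    linarith
  exact (key hy).2 rfl

lemma concaveOn_ironedRevenue (hnn : ∀ᵐ x ∂μ, 0 ≤ x)
    (ht : Tendsto (fun x : ℝ => x * μ.real (Ici x)) atTop (𝓝 0)) :
    ConcaveOn ℝ (Icc 0 1) (ironedRevenue μ) := by
  refine ⟨convex_Icc 0 1, fun x hx y hy a b ha hb hab => ?_⟩
  -- The supremum defining the curve need not be attained, so it is approximated within ε.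
  refine le_of_forall_pos_lt_add fun ε hε => ?_
  have approx : ∀ q ∈ Icc (0 : ℝ) 1, ∃ u, (q, u) ∈ convexHull ℝ (revenuePoints μ) ∧
      ironedRevenue μ q - ε < u := fun q hq =>
    exists_lt_of_lt_csSup (s := {y : ℝ | (q, y) ∈ convexHull ℝ (revenuePoints μ)})
      ⟨0, mk_zero_mem_convexHull_revenuePoints hnn hq⟩ (sub_lt_self _ hε)
  obtain ⟨u, hu, hu'⟩ := approx x hx
  obtain ⟨v, hv, hv'⟩ := approx y hy
  have := le_ironedRevenue ht (convex_convexHull ℝ (revenuePoints μ) hu hv ha hb hab)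
  simp only [Prod.smul_snd, Prod.smul_fst, smul_eq_mul] at this ⊢
  obtain rfl : b = 1 - a := by linarith
  have h1 : a * (ironedRevenue μ x - ε) + (1 - a) * (ironedRevenue μ y - ε) < a * u + (1 - a) * v := by
    rcases ha.eq_or_lt with rfl | ha
    · simpa using hv'
    · have := mul_lt_mul_of_pos_left hu' ha
      have := mul_le_mul_of_nonneg_left hv'.le hb
      linarith
  linarith

/-- The chord of a concave function over an interval inside `[x, z]` that shares no interior
point, in product form. -/
lemma ConcaveOn.mul_le_mul_add {f : ℝ → ℝ} {S : Set ℝ} (hf : ConcaveOn ℝ S f) {x y z : ℝ}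
    (hx : x ∈ S) (hz : z ∈ S) (hxy : x ≤ y) (hyz : y ≤ z) :
    (z - y) * f x + (y - x) * f z ≤ (z - x) * f y := by
  rcases (hxy.trans hyz).eq_or_lt with rfl | hlt
  · obtain rfl : x = y := le_antisymm hxy hyz
    simp
  have h0 : 0 < z - x := sub_pos.2 hlt
  have := hf.2 hx hz (div_nonneg (sub_nonneg.2 hyz) h0.le) (div_nonneg (sub_nonneg.2 hxy) h0.le)
    (by field_simp; ring)
  simp only [smul_eq_mul] at this
  rw [show (z - y) / (z - x) * x + (y - x) / (z - x) * z = y by field_simp; ring] at this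
  have h2 := mul_le_mul_of_nonneg_left this h0.le
  calc _ = (z - x) * ((z - y) / (z - x) * f x + (y - x) / (z - x) * f z) := by field_simp
    _ ≤ _ := h2

lemma measureReal_mem_Icc (s : Set ℝ) : μ.real s ∈ Icc (0 : ℝ) 1 :=
  ⟨measureReal_nonneg, measureReal_le_one⟩

/-- The ironed revenue curve has a right-hand derivative at every quantile `P(v > x) < 1`. -/
lemma differentiableWithinAt_ironedRevenue (hnn : ∀ᵐ x ∂μ, 0 ≤ x)
    (ht : Tendsto (fun x : ℝ => x * μ.real (Ici x)) atTop (𝓝 0)) {x : ℝ}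
    (hx : μ.real (Ioi x) < 1) :
    DifferentiableWithinAt ℝ (ironedRevenue μ) (Ioi (μ.real (Ioi x))) (μ.real (Ioi x)) := by
  have hc := concaveOn_ironedRevenue hnn ht
  set a := μ.real (Ioi x) with ha
  have ha0 : 0 ≤ a := measureReal_nonneg
  rcases ha0.eq_or_lt with h0 | h0
  -- At the endpoint 0 a concave function could have infinite slope. Here almost no value exceeds x,
  -- so the curve stays below the line of slope x through the origin.
  · have hbound : ∀ z ∈ revenuePoints μ, z.2 ≤ x * z.1 + 0 := by
      refine forall_mem_revenuePoints (by simp) fun p hp => ?_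
      simp only [add_zero]
      rcases le_or_gt p x with h | h
      · exact mul_le_mul_of_nonneg_right h measureReal_nonneg
      · have : μ.real (Ici p) = 0 :=
          le_antisymm ((measureReal_mono (Ici_subset_Ioi.2 h)).trans_eq (ha.symm.trans h0.symm))
            measureReal_nonneg
        simp [this]
    rw [← h0]
    have hR0 := ironedRevenue_zero hnn ht
    have hanti : AntitoneOn (slope (ironedRevenue μ) 0) (Ioo 0 1) := by
      intro q hq r hr hqr
      have := hc.mul_le_mul_add (x := 0) (by simp) (Ioo_subset_Icc_self hr) hq.1.le hqr
      simp only [slope_def_field, hR0, sub_zero, mul_zero, zero_add] at this ⊢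
      rw [div_le_div_iff₀ hr.1 hq.1]
      linarith
    have hbdd : BddAbove (slope (ironedRevenue μ) 0 '' Ioo 0 1) := by
      refine ⟨x, ?_⟩
      rintro _ ⟨q, hq, rfl⟩
      simp only [slope_def_field, hR0, sub_zero]
      rw [div_le_iff₀ hq.1]
      simpa using ironedRevenue_le hnn hbound (Ioo_subset_Icc_self hq)
    have := hanti.tendsto_nhdsWithin_Ioo_right (nonempty_Ioo.2 one_pos) hbdd
    exact ((hasDerivWithinAt_iff_tendsto_slope' (by simp)).2 this).differentiableWithinAt
  · have hint : a ∈ interior (Icc (0 : ℝ) 1) := by simp [interior_Icc, h0, hx]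
    have := (hc.neg.hasDerivWithinAt_rightDeriv_of_mem_interior hint).neg
    simpa using this.differentiableWithinAt

/-- The ironed virtual value of `x` exceeds `s` iff some chord of the ironed revenue curve to the
right of `P(v > x)` has slope above `s`. -/
lemma lt_ironedVirtualValue_iff (hnn : ∀ᵐ x ∂μ, 0 ≤ x)
    (ht : Tendsto (fun x : ℝ => x * μ.real (Ici x)) atTop (𝓝 0)) {x s : ℝ} :
    (s : EReal) < ironedVirtualValue μ x ↔ ∃ q ∈ Ioc (μ.real (Ioi x)) 1,
      s * (q - μ.real (Ioi x)) < ironedRevenue μ q - ironedRevenue μ (μ.real (Ioi x)) := by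
  by_cases hx : μ.real (Ioi x) < 1
  · have hd := differentiableWithinAt_ironedRevenue hnn ht hx
    have hc := concaveOn_ironedRevenue hnn ht
    rw [ironedVirtualValue_of_lt hx, EReal.coe_lt_coe_iff]
    set a := μ.real (Ioi x) with ha
    have haI : a ∈ Icc (0 : ℝ) 1 := measureReal_mem_Icc _
    constructor
    · intro h
      have h1 := (hasDerivWithinAt_iff_tendsto_slope' (by simp)).1 hd.hasDerivWithinAt
      obtain ⟨q, hq, hqI⟩ := ((h1.eventually_const_lt h).and
        (Ioc_mem_nhdsGT hx)).exists
      refine ⟨q, hqI, ?_⟩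
      rwa [slope_def_field, lt_div_iff₀ (sub_pos.2 hqI.1)] at hq
    · rintro ⟨q, hq, hlt⟩
      have := hc.slope_le_rightDeriv haI ⟨haI.1.trans hq.1.le, hq.2⟩ hq.1 hd
      refine lt_of_lt_of_le ?_ this
      rwa [slope_def_field, lt_div_iff₀ (sub_pos.2 hq.1)]
  · have : ironedVirtualValue μ x = ⊥ := if_neg hx
    rw [this]
    refine ⟨fun h => absurd h not_lt_bot, ?_⟩
    rintro ⟨q, hq, -⟩
    exact absurd (hq.1.trans_le hq.2) hx

lemma ironedVirtualValue_of_neg (hnn : ∀ᵐ x ∂μ, 0 ≤ x) {x : ℝ} (hx : x < 0) :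
    ironedVirtualValue μ x = ⊥ := by
  refine if_neg (not_lt.2 ?_)
  rw [← measureReal_Ici_zero hnn]
  exact measureReal_mono (Ici_subset_Ioi.2 hx)

/-- A larger value has a smaller quantile, and a chord of a concave function gets no flatter when
its left end moves left. -/
lemma monotone_ironedVirtualValue (hnn : ∀ᵐ x ∂μ, 0 ≤ x)
    (ht : Tendsto (fun x : ℝ => x * μ.real (Ici x)) atTop (𝓝 0)) :
    Monotone (ironedVirtualValue μ) := by
  intro x y hxy
  refine le_of_not_gt fun hlt => ?_
  obtain ⟨s, hs1, hs2⟩ := EReal.lt_iff_exists_real_btwn.1 hlt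
  refine absurd ((lt_ironedVirtualValue_iff hnn ht).2 ?_) hs1.not_gt
  obtain ⟨q, hq, h⟩ := (lt_ironedVirtualValue_iff hnn ht).1 hs2
  have hle : μ.real (Ioi y) ≤ μ.real (Ioi x) := measureReal_mono (Ioi_subset_Ioi hxy)
  have hy0 := measureReal_mem_Icc (μ := μ) (Ioi y)
  have hc := (concaveOn_ironedRevenue hnn ht).mul_le_mul_add hy0
    ⟨(measureReal_nonneg.trans hq.1.le), hq.2⟩ hle hq.1.le
  refine ⟨q, ⟨hle.trans_lt hq.1, hq.2⟩, ?_⟩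
  have h1 : 0 < q - μ.real (Ioi x) := sub_pos.2 hq.1
  have h2 : 0 ≤ μ.real (Ioi x) - μ.real (Ioi y) := sub_nonneg.2 hle
  have h3 := mul_lt_mul_of_pos_left h (show 0 < q - μ.real (Ioi y) by linarith)
  refine lt_of_mul_lt_mul_left ?_ h1.le
  nlinarith

end Revenue

/-! ### Threshold prices earn the ironed revenue -/

section Threshold

variable {μ : Measure ℝ} [IsProbabilityMeasure μ]

lemma measureReal_Ioi_eq_one_sub_cdf (x : ℝ) : μ.real (Ioi x) = 1 - cdf μ x := by
  rw [cdf_eq_real, ← probReal_compl_eq_one_sub measurableSet_Iic, compl_Iic]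

lemma measureReal_Ici_eq_one_sub_leftLim (x : ℝ) :
    μ.real (Ici x) = 1 - Function.leftLim (cdf μ) x := by
  have h := (cdf μ).measure_Ici (tendsto_cdf_atTop μ) x
  rw [measure_cdf] at h
  rw [measureReal_def, h, ENNReal.toReal_ofReal]
  exact sub_nonneg.2 (((cdf μ).mono.leftLim_le le_rfl).trans (cdf_le_one μ x))

lemma tendsto_measureReal_Ioi_nhdsLT (p : ℝ) :
    Tendsto (fun x => μ.real (Ioi x)) (𝓝[<] p) (𝓝 (μ.real (Ici p))) := by
  simp_rw [measureReal_Ioi_eq_one_sub_cdf, measureReal_Ici_eq_one_sub_leftLim]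
  exact ((cdf μ).mono.tendsto_leftLim p).const_sub 1

lemma tendsto_measureReal_Ioi_nhdsGT (p : ℝ) :
    Tendsto (fun x => μ.real (Ioi x)) (𝓝[>] p) (𝓝 (μ.real (Ioi p))) := by
  simp_rw [measureReal_Ioi_eq_one_sub_cdf]
  exact (((cdf μ).right_continuous p).tendsto.mono_left
    (nhdsWithin_mono p Ioi_subset_Ici_self)).const_sub 1

lemma tendsto_measureReal_Ioi_atTop :
    Tendsto (fun x => μ.real (Ioi x)) atTop (𝓝 0) := by
  simp_rw [measureReal_Ioi_eq_one_sub_cdf]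
  simpa using (tendsto_cdf_atTop μ).const_sub 1

lemma tendsto_measureReal_Ici_atTop :
    Tendsto (fun x => μ.real (Ici x)) atTop (𝓝 0) := by
  refine squeeze_zero (fun _ => measureReal_nonneg) (fun x => measureReal_mono
    (Ici_subset_Ioi.2 (sub_one_lt x))) ?_
  exact tendsto_measureReal_Ioi_atTop.comp (tendsto_atTop_add_const_right _ (-1) tendsto_id)

/-- The price `p` maximizes `(p - s) · P(v ≥ p)`, the revenue net of a production cost `s`, and this
maximum is positive. -/
def IsNetOptimalPrice (μ : Measure ℝ) (s p : ℝ) : Prop :=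
  0 ≤ p ∧ 0 < (p - s) * μ.real (Ici p) ∧
    ∀ z ∈ revenuePoints μ, z.2 ≤ s * z.1 + (p - s) * μ.real (Ici p)

/-- The net revenue is upper semicontinuous where it is positive, since the selling probability is
nonincreasing and left-continuous. It vanishes at infinity by the tail hypothesis, so a maximizing
sequence eventually stays in a compact interval. -/
lemma exists_isNetOptimalPrice (ht : Tendsto (fun x : ℝ => x * μ.real (Ici x)) atTop (𝓝 0)) {s : ℝ}
    (h : ∃ z ∈ revenuePoints μ, s * z.1 < z.2) : ∃ p, IsNetOptimalPrice μ s p := by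
  set V : ℝ → ℝ := fun p => (p - s) * μ.real (Ici p) with hV
  obtain ⟨B, hB⟩ := exists_revenuePoints_le ht
  have hbdd : BddAbove (V '' Ici 0) := by
    refine ⟨B + |s|, ?_⟩
    rintro _ ⟨p, hp, rfl⟩
    have h1 : p * μ.real (Ici p) ≤ B := hB _ (price_mem_revenuePoints hp)
    have h2 : -s * μ.real (Ici p) ≤ |s| * 1 :=
      mul_le_mul (neg_le_abs s) measureReal_le_one measureReal_nonneg (abs_nonneg s)
    simp only [hV]
    linarith
  obtain ⟨p₀, hp₀, hp₀V⟩ : ∃ p, 0 ≤ p ∧ 0 < V p := by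
    obtain ⟨z, rfl | ⟨p, hp, rfl⟩, hz⟩ := h
    · simp at hz
    · exact ⟨p, hp, by simp only [hV]; simp only at hz; linarith⟩
  set M := sSup (V '' Ici 0) with hM
  have hle : ∀ p, 0 ≤ p → V p ≤ M := fun p hp => le_csSup hbdd (mem_image_of_mem _ hp)
  have hMpos : 0 < M := hp₀V.trans_le (hle p₀ hp₀)
  have hVlim : Tendsto V atTop (𝓝 0) := by
    have := ht.sub ((tendsto_measureReal_Ici_atTop (μ := μ)).const_mul s)
    simp only [mul_zero, sub_zero] at this
    exact this.congr fun x => by simp only [hV]; ring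
  obtain ⟨N, hN⟩ := eventually_atTop.1 (hVlim.eventually_lt_const (half_pos hMpos))
  obtain ⟨u, -, hu, huV⟩ := exists_seq_tendsto_sSup (⟨V 0, mem_image_of_mem _ self_mem_Ici⟩ :
    (V '' Ici 0).Nonempty) hbdd
  choose r hr0 hrV using huV
  have hev : ∀ᶠ n in atTop, M / 2 < V (r n) := by
    simp_rw [hrV]
    exact hu.eventually_const_lt (half_lt_self hMpos)
  have hfreq : ∃ᶠ n in atTop, r n ∈ Icc 0 N := by
    refine Eventually.frequently ?_
    filter_upwards [hev] with n hn
    refine ⟨hr0 n, le_of_not_gt fun hlt => ?_⟩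
    exact lt_asymm hn (hN _ hlt.le)
  obtain ⟨p, hpI, φ, hφ, hlim⟩ := isCompact_Icc.tendsto_subseq' hfreq
  have hVφ : Tendsto (fun n => V (r (φ n))) atTop (𝓝 M) := by
    simp_rw [hrV]
    exact hu.comp hφ.tendsto_atTop
  -- The prices may approach p from either side, but eventually exceed any x < p and then sell with
  -- probability at most P(v > x). Letting x increase to p recovers P(v ≥ p).
  have hlow : ∀ x < p, M ≤ (p - s) * μ.real (Ioi x) := by
    intro x hx
    refine le_of_tendsto_of_tendsto hVφ ((hlim.sub_const s).mul_const _) ?_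
    filter_upwards [hlim.eventually_const_lt hx, hφ.tendsto_atTop.eventually hev] with n h1 h2
    have h3 : 0 < r (φ n) - s := by
      by_contra! h
      exact (mul_nonpos_of_nonpos_of_nonneg h measureReal_nonneg).not_gt
        ((half_pos hMpos).trans h2)
    exact mul_le_mul_of_nonneg_left (measureReal_mono (Ici_subset_Ioi.2 h1)) h3.le
  have hfin : M ≤ V p :=
    ge_of_tendsto ((tendsto_measureReal_Ioi_nhdsLT p).const_mul (p - s))
      (eventually_nhdsWithin_of_forall fun x hx => hlow x hx)
  refine ⟨p, hpI.1, hMpos.trans_le hfin, forall_mem_revenuePoints ?_ fun x hx => ?_⟩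
  · simpa using (hMpos.trans_le hfin).le
  · have := (hle x hx).trans hfin
    simp only [hV] at this ⊢
    linarith

variable (hnn : ∀ᵐ x ∂μ, 0 ≤ x) (ht : Tendsto (fun x : ℝ => x * μ.real (Ici x)) atTop (𝓝 0))
include hnn

lemma IsNetOptimalPrice.ironedRevenue_le {s p y : ℝ} (hp : IsNetOptimalPrice μ s p)
    (hy : y ∈ Icc (0 : ℝ) 1) : ironedRevenue μ y ≤ s * y + (p - s) * μ.real (Ici p) :=
  _root_.ironedRevenue_le hnn hp.2.2 hy

include ht

/-- The price p marks a point where a line of slope s touches the ironed curve from above; by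
concavity, chords starting at or to the right of that point have slope at most s. -/
lemma IsNetOptimalPrice.le_and_lt_of_lt {s p x : ℝ} (hp : IsNetOptimalPrice μ s p)
    (hx : (s : EReal) < ironedVirtualValue μ x) : p ≤ x ∧ μ.real (Ioi x) < μ.real (Ici p) := by
  have key : μ.real (Ioi x) < μ.real (Ici p) := by
    by_contra! hle
    obtain ⟨q, hq, h⟩ := (lt_ironedVirtualValue_iff hnn ht).1 hx
    have hqI : q ∈ Icc (0 : ℝ) 1 := ⟨measureReal_nonneg.trans hq.1.le, hq.2⟩
    have h1 := (concaveOn_ironedRevenue hnn ht).mul_le_mul_add (measureReal_mem_Icc (Ici p)) hqI hle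
      hq.1.le
    have h2 := price_le_ironedRevenue ht hp.1
    have h3 := hp.ironedRevenue_le hnn hqI
    have h4 : 0 < q - μ.real (Ioi x) := sub_pos.2 hq.1
    have h5 : 0 ≤ μ.real (Ioi x) - μ.real (Ici p) := sub_nonneg.2 hle
    set G := μ.real (Ici p)
    set a := μ.real (Ioi x)
    nlinarith [mul_le_mul_of_nonneg_left h2 h4.le, mul_le_mul_of_nonneg_left h3 h4.le,
      mul_lt_mul_of_pos_left h (show 0 < q - G by linarith)]
  refine ⟨le_of_not_gt fun h => ?_, key⟩
  exact key.not_ge (measureReal_mono (Ici_subset_Ioi.2 h))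

/-- Chords that end at the touching point, coming from the left, have slope at least s. -/
lemma IsNetOptimalPrice.le_and_le_of_lt {s p x : ℝ} (hp : IsNetOptimalPrice μ s p) (hx0 : 0 ≤ x)
    (hx : ironedVirtualValue μ x < s) : x ≤ p ∧ μ.real (Ici p) ≤ μ.real (Ioi x) := by
  have key : μ.real (Ici p) ≤ μ.real (Ioi x) := by
    by_contra! hlt
    obtain ⟨s', h1, h2⟩ := EReal.lt_iff_exists_real_btwn.1 hx
    rw [EReal.coe_lt_coe_iff] at h2
    refine h1.not_gt ((lt_ironedVirtualValue_iff hnn ht).2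
      ⟨_, ⟨hlt, measureReal_le_one (μ := μ)⟩, ?_⟩)
    have h3 := price_le_ironedRevenue ht hp.1
    have h4 := hp.ironedRevenue_le hnn (measureReal_mem_Icc (μ := μ) (Ioi x))
    have h5 := mul_lt_mul_of_pos_right h2 (sub_pos.2 hlt)
    linarith
  -- A price x > p would sell exactly as often as p and earn more.
  refine ⟨le_of_not_gt fun h => ?_, key⟩
  have hG : μ.real (Ici x) = μ.real (Ici p) :=
    le_antisymm (measureReal_mono (Ici_subset_Ici.2 h.le))
      (key.trans (measureReal_mono Ioi_subset_Ici_self))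
  have h1 := hp.2.2 _ (price_mem_revenuePoints hx0)
  simp only [hG] at h1
  have h2 : 0 < μ.real (Ici p) := by
    refine measureReal_nonneg.lt_of_ne fun h0 => ?_
    have := hp.2.1
    simp [← h0] at this
  have : x * μ.real (Ici p) ≤ p * μ.real (Ici p) := by linarith
  exact (le_of_mul_le_mul_right this h2).not_gt h

/-- By concavity, the chord from the origin to q is at least as steep as the one from P(v > x) to q.
This supplies the hypothesis of `exists_isNetOptimalPrice`. -/
lemma exists_lt_of_lt_ironedVirtualValue {s x : ℝ} (hx : (s : EReal) < ironedVirtualValue μ x) :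
    ∃ z ∈ revenuePoints μ, s * z.1 < z.2 := by
  by_contra! H
  obtain ⟨q, hq, h⟩ := (lt_ironedVirtualValue_iff hnn ht).1 hx
  have ha : 0 ≤ μ.real (Ioi x) := measureReal_nonneg
  have hqI : q ∈ Icc (0 : ℝ) 1 := ⟨ha.trans hq.1.le, hq.2⟩
  have h1 := (concaveOn_ironedRevenue hnn ht).mul_le_mul_add (x := 0) (by simp) hqI ha hq.1.le
  have h2 := ironedRevenue_le hnn (s := s) (h := 0) (by simpa using H) hqI
  rw [ironedRevenue_zero hnn ht] at h1
  have h4 : 0 < q - μ.real (Ioi x) := sub_pos.2 hq.1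
  have hq0 : 0 < q := ha.trans_lt hq.1
  set a := μ.real (Ioi x)
  nlinarith [mul_le_mul_of_nonneg_left h2 h4.le, mul_lt_mul_of_pos_left h hq0]

omit ht in
/-- If prices `p n` sandwich the threshold of an upper set `W` of values, with the corresponding
selling probabilities, then their net revenues tend to that of `W`. -/
lemma tendsto_netRevenue {W : Set ℝ} (hW0 : ∀ x ∈ W, 0 ≤ x) (hup : ∀ x ∈ W, ∀ y, x ≤ y → y ∈ W)
    (hne : W.Nonempty) {s : ℝ} {t p : ℕ → ℝ} (ht : Tendsto t atTop (𝓝 s))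
    (hp : ∀ᶠ n in atTop, 0 ≤ p n)
    (hin : ∀ x ∈ W, ∀ᶠ n in atTop, p n ≤ x ∧ μ.real (Ioi x) < μ.real (Ici (p n)))
    (hout : ∀ x, 0 ≤ x → x ∉ W → ∀ᶠ n in atTop, x ≤ p n ∧ μ.real (Ici (p n)) ≤ μ.real (Ioi x)) :
    Tendsto (fun n => (p n - t n) * μ.real (Ici (p n))) atTop
      (𝓝 ((sInf W - s) * μ.real W)) := by
  have hbdd : BddBelow W := ⟨0, hW0⟩
  have hq0 : 0 ≤ sInf W := Real.sInf_nonneg hW0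
  have hnot : ∀ x < sInf W, x ∉ W := fun x hx hxW => hx.not_ge (csInf_le hbdd hxW)
  have hyes : ∀ x, sInf W < x → x ∈ W := fun x hx => by
    obtain ⟨w, hw, hwx⟩ := exists_lt_of_csInf_lt hne hx
    exact hup w hw x hwx.le
  have hplim : Tendsto p atTop (𝓝 (sInf W)) := by
    refine tendsto_order.2 ⟨fun u hu => ?_, fun u hu => ?_⟩
    · rcases lt_or_ge u 0 with h | h
      · filter_upwards [hp] with n hn using h.trans_le hn
      · obtain ⟨m, hm1, hm2⟩ := exists_between hu
        filter_upwards [hout m (h.trans hm1.le) (hnot m hm2)] with n hn using hm1.trans_le hn.1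
    · obtain ⟨w, hw, hwu⟩ := exists_lt_of_csInf_lt hne hu
      filter_upwards [hin w hw] with n hn using hn.1.trans_lt hwu
  refine (hplim.sub ht).mul ?_
  -- The set W is `Ici` or `Ioi` of its infimum. The limit of the selling probabilities rests on the
  -- left limit of P(v > ·) in the first case and on its right-continuity in the second.
  by_cases hmem : sInf W ∈ W
  · have hWeq : W = Ici (sInf W) :=
      Subset.antisymm (fun x hx => csInf_le hbdd hx) fun x hx => hup _ hmem x hx
    have hreal : μ.real W = μ.real (Ici (sInf W)) := congrArg μ.real hWeq
    rw [hreal]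
    refine tendsto_order.2 ⟨fun l hl => ?_, fun u hu => ?_⟩
    · filter_upwards [hin _ hmem] with n hn
      exact hl.trans_le (measureReal_mono (Ici_subset_Ici.2 hn.1))
    -- At infimum 0 there is no smaller nonnegative value to compare with, but the selling
    -- probability is already 1.
    · rcases hq0.eq_or_lt with h0 | h0
      · rw [← h0, measureReal_Ici_zero hnn] at hu
        exact Eventually.of_forall fun n => measureReal_le_one.trans_lt hu
      · obtain ⟨x, hx1, hx2⟩ := (((tendsto_measureReal_Ioi_nhdsLT (μ := μ) (sInf W)).eventually_lt_const
          hu).and (Ioo_mem_nhdsLT h0)).exists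
        filter_upwards [hout x hx2.1.le (hnot x hx2.2)] with n hn using hn.2.trans_lt hx1
  · have hWeq : W = Ioi (sInf W) :=
      Subset.antisymm (fun x hx => (csInf_le hbdd hx).lt_of_ne fun h => hmem (h ▸ hx)) hyes
    have hreal : μ.real W = μ.real (Ioi (sInf W)) := congrArg μ.real hWeq
    rw [hreal]
    refine tendsto_order.2 ⟨fun l hl => ?_, fun u hu => ?_⟩
    · obtain ⟨x, hx1, hx2⟩ := (((tendsto_measureReal_Ioi_nhdsGT (μ := μ) (sInf W)).eventually_const_lt
          hl).and self_mem_nhdsWithin).exists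
      filter_upwards [hin x (hyes x hx2)] with n hn using hx1.trans hn.2
    · filter_upwards [hout _ hq0 hmem] with n hn using hn.2.trans_lt hu

/-- `W` is one of the sets of values whose ironed virtual value is at least `s`, or above `s`. -/
def IsVirtualUpperSet (μ : Measure ℝ) (s : ℝ) (W : Set ℝ) : Prop :=
  W = {x | (s : EReal) ≤ ironedVirtualValue μ x} ∨ W = {x | (s : EReal) < ironedVirtualValue μ x}

omit ht in
lemma IsVirtualUpperSet.nonneg_of_mem {s : ℝ} {W : Set ℝ} (hW : IsVirtualUpperSet μ s W) {x : ℝ}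
    (hx : x ∈ W) : 0 ≤ x := by
  by_contra! h
  have hb := ironedVirtualValue_of_neg hnn h
  rcases hW with rfl | rfl <;> simp [hb] at hx

lemma IsVirtualUpperSet.mem_of_le {s : ℝ} {W : Set ℝ} (hW : IsVirtualUpperSet μ s W) {x y : ℝ}
    (hx : x ∈ W) (hxy : x ≤ y) : y ∈ W := by
  have hm := monotone_ironedVirtualValue hnn ht hxy
  rcases hW with rfl | rfl
  · exact le_trans (show (s : EReal) ≤ _ from hx) hm
  · exact lt_of_lt_of_le (show (s : EReal) < _ from hx) hm

/-- At cost exactly s several prices may be optimal. Costs slightly below s (when W contains level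
s) or slightly above s (when it does not) put the values of level s on the correct side of the
optimal price. -/
lemma IsVirtualUpperSet.exists_netRevenue_tendsto {s : ℝ} {W : Set ℝ}
    (hW : IsVirtualUpperSet μ s W) (hne : W.Nonempty) :
    ∃ t p : ℕ → ℝ, Tendsto t atTop (𝓝 s) ∧ (∀ᶠ n in atTop, IsNetOptimalPrice μ (t n) (p n)) ∧
      Tendsto (fun n => (p n - t n) * μ.real (Ici (p n))) atTop (𝓝 ((sInf W - s) * μ.real W)) := by
  obtain ⟨t, htlim, hin, hout⟩ : ∃ t : ℕ → ℝ, Tendsto t atTop (𝓝 s) ∧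
      (∀ x ∈ W, ∀ᶠ n in atTop, (t n : EReal) < ironedVirtualValue μ x) ∧
      (∀ x ∉ W, ∀ᶠ n in atTop, ironedVirtualValue μ x < t n) := by
    have hcoe := (continuous_coe_real_ereal.tendsto s)
    rcases hW with rfl | rfl
    · refine ⟨fun n => s - 1 / ((n : ℝ) + 1), by
        simpa using tendsto_one_div_add_atTop_nhds_zero_nat.const_sub s, fun x hx => ?_,
        fun x hx => ?_⟩
      · refine Eventually.of_forall fun n => lt_of_lt_of_le ?_ hx
        rw [EReal.coe_lt_coe_iff]
        exact sub_lt_self _ Nat.one_div_pos_of_nat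
      · refine (hcoe.comp ?_).eventually_const_lt (not_le.1 hx)
        simpa using (tendsto_one_div_add_atTop_nhds_zero_nat (𝕜 := ℝ)).const_sub s
    · refine ⟨fun n => s + 1 / ((n : ℝ) + 1), by
        simpa using tendsto_one_div_add_atTop_nhds_zero_nat.const_add s, fun x hx => ?_,
        fun x hx => ?_⟩
      · refine (hcoe.comp ?_).eventually_lt_const hx
        simpa using (tendsto_one_div_add_atTop_nhds_zero_nat (𝕜 := ℝ)).const_add s
      · refine Eventually.of_forall fun n => lt_of_le_of_lt (not_lt.1 hx) ?_
        rw [EReal.coe_lt_coe_iff]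
        exact lt_add_of_pos_right _ Nat.one_div_pos_of_nat
  obtain ⟨x₀, hx₀⟩ := hne
  obtain ⟨p, hp⟩ := Filter.Eventually.choice ((hin x₀ hx₀).mono fun n hn =>
    exists_isNetOptimalPrice ht (exists_lt_of_lt_ironedVirtualValue hnn ht hn))
  refine ⟨t, p, htlim, hp, tendsto_netRevenue hnn (fun x hx => hW.nonneg_of_mem hnn hx)
    (fun x hx y hxy => hW.mem_of_le hnn ht hx hxy) ⟨x₀, hx₀⟩ htlim (hp.mono fun n hn => hn.1)
    (fun x hx => ?_) fun x hx0 hx => ?_⟩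
  · filter_upwards [hp, hin x hx] with n h1 h2 using h1.le_and_lt_of_lt hnn ht h2
  · filter_upwards [hp, hout x hx] with n h1 h2 using h1.le_and_le_of_lt hnn ht hx0 h2

/-- This is the limit of the supporting lines given by the net-optimal prices. -/
lemma IsVirtualUpperSet.ironedRevenue_le {s : ℝ} {W : Set ℝ} (hW : IsVirtualUpperSet μ s W) {y : ℝ}
    (hy : y ∈ Icc (0 : ℝ) 1) :
    ironedRevenue μ y ≤ s * y + (sInf W - s) * μ.real W := by
  rcases W.eq_empty_or_nonempty with rfl | hne
  -- For empty W the claim is R(y) ≤ s y. An optimal price at a cost s' > s would never sell, which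
  -- contradicts its positive net revenue.
  · have hle : ∀ x, ironedVirtualValue μ x ≤ s := by
      intro x
      rcases hW with h | h
      · exact (not_le.1 fun hx => (h ▸ hx : x ∈ (∅ : Set ℝ)).elim).le
      · exact not_lt.1 fun hx => (h ▸ hx : x ∈ (∅ : Set ℝ)).elim
    simp only [measureReal_empty, mul_zero, add_zero]
    have key : ∀ s' > s, ironedRevenue μ y ≤ s' * y := by
      intro s' hs'
      have : ∀ z ∈ revenuePoints μ, z.2 ≤ s' * z.1 := by
        by_contra! H
        obtain ⟨p, hp⟩ := exists_isNetOptimalPrice ht H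
        have h0 : μ.real (Ici p) ≤ 0 := by
          refine ge_of_tendsto (tendsto_measureReal_Ioi_atTop (μ := μ))
            ((eventually_ge_atTop 0).mono fun x hx => ?_)
          exact (hp.le_and_le_of_lt hnn ht hx
            ((hle x).trans_lt (EReal.coe_lt_coe_iff.2 hs'))).2
        have := hp.2.1
        rw [le_antisymm h0 measureReal_nonneg, mul_zero] at this
        exact lt_irrefl _ this
      simpa using _root_.ironedRevenue_le hnn (h := 0) (by simpa using this) hy
    refine ge_of_tendsto (f := fun s' => s' * y) (x := 𝓝[>] s) ?_
      (eventually_nhdsWithin_of_forall key)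
    exact (continuous_mul_const y).continuousWithinAt
  · obtain ⟨t, p, h1, h2, h3⟩ := hW.exists_netRevenue_tendsto hnn ht hne
    exact ge_of_tendsto ((h1.mul_const y).add h3) (h2.mono fun n hn => hn.ironedRevenue_le hnn hy)

lemma IsVirtualUpperSet.sInf_mul_le {s : ℝ} {W : Set ℝ} (hW : IsVirtualUpperSet μ s W) :
    sInf W * μ.real W ≤ ironedRevenue μ (μ.real W) := by
  have hW0 : ∀ x ∈ W, 0 ≤ x := fun x hx => hW.nonneg_of_mem hnn hx
  have hq0 : 0 ≤ sInf W := Real.sInf_nonneg hW0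
  have hbdd : BddBelow W := ⟨0, hW0⟩
  rcases W.eq_empty_or_nonempty with rfl | hne
  · simp [ironedRevenue_zero hnn ht]
  by_cases hmem : sInf W ∈ W
  · have hWeq : W = Ici (sInf W) :=
      Subset.antisymm (fun x hx => csInf_le hbdd hx) fun x hx => hW.mem_of_le hnn ht hmem hx
    have hreal : μ.real W = μ.real (Ici (sInf W)) := congrArg μ.real hWeq
    rw [hreal]
    exact price_le_ironedRevenue ht hq0
  · have hWeq : W = Ioi (sInf W) :=
      Subset.antisymm (fun x hx => (csInf_le hbdd hx).lt_of_ne fun h => hmem (h ▸ hx))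
        fun x hx => by
          obtain ⟨w, hw, hwx⟩ := exists_lt_of_csInf_lt hne hx
          exact hW.mem_of_le hnn ht hw hwx.le
    have hreal : μ.real W = μ.real (Ioi (sInf W)) := congrArg μ.real hWeq
    rw [hreal]
    -- The point for selling strictly above the infimum lies on the segment from the origin to the
    -- point for selling at the infimum, hence below the concave curve.
    have hle : μ.real (Ioi (sInf W)) ≤ μ.real (Ici (sInf W)) :=
      measureReal_mono Ioi_subset_Ici_self
    have h1 := (concaveOn_ironedRevenue hnn ht).mul_le_mul_add (x := 0) (by simp)
      (measureReal_mem_Icc (μ := μ) (Ici (sInf W))) measureReal_nonneg hle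
    have h2 := mul_le_mul_of_nonneg_left (price_le_ironedRevenue ht hq0)
      (measureReal_nonneg (μ := μ) (s := Ioi (sInf W)))
    rw [ironedRevenue_zero hnn ht] at h1
    rcases (measureReal_nonneg (μ := μ) (s := Ici (sInf W))).eq_or_lt with h0 | h0
    · have : μ.real (Ioi (sInf W)) = 0 := le_antisymm (hle.trans_eq h0.symm) measureReal_nonneg
      simp [this, ironedRevenue_zero hnn ht]
    · refine le_of_mul_le_mul_left ?_ h0
      linarith

/-- Selling at the threshold of `W` earns the ironed revenue. -/
lemma IsVirtualUpperSet.ironedRevenue_eq {s : ℝ} {W : Set ℝ} (hW : IsVirtualUpperSet μ s W) :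
    ironedRevenue μ (μ.real W) = sInf W * μ.real W := by
  refine le_antisymm ?_ (hW.sInf_mul_le hnn ht)
  have := hW.ironedRevenue_le hnn ht (measureReal_mem_Icc (μ := μ) W)
  linarith

/-- The slope `s` supports the ironed revenue curve at the quantile of `W`. -/
lemma IsVirtualUpperSet.ironedRevenue_le_add {s : ℝ} {W : Set ℝ} (hW : IsVirtualUpperSet μ s W)
    {y : ℝ} (hy : y ∈ Icc (0 : ℝ) 1) :
    ironedRevenue μ y ≤ ironedRevenue μ (μ.real W) + s * (y - μ.real W) := by
  have := hW.ironedRevenue_le hnn ht hy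
  rw [hW.ironedRevenue_eq hnn ht]
  linarith

end Threshold

/-! ### An inequality for exclusion weights -/

/-- For weights 0 and 1 the sum indicates that exactly one weight is 1, the last term that none is.
In general let t be the total: for t ≤ 1 the claim reduces to ∑ l j ^ 2 ≤ t ^ 2, and for t ≥ 1 each
exclusion factor is at most 1 / t because t (2 - t) ≤ 1. -/
lemma sum_mul_exclusion_le_one {ι : Type*} [DecidableEq ι] (S : Finset ι) (l : ι → ℝ)
    (h0 : ∀ i ∈ S, 0 ≤ l i) (h1 : ∀ i ∈ S, l i ≤ 1) :
    ∑ j ∈ S, l j * max 0 (1 - ∑ k ∈ S.erase j, l k) + max 0 (1 - ∑ k ∈ S, l k) ≤ 1 := by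
  have he : ∀ j ∈ S, 1 - ∑ k ∈ S.erase j, l k = 1 - ∑ k ∈ S, l k + l j := fun j hj => by
    rw [← Finset.add_sum_erase S l hj]; ring
  set t := ∑ k ∈ S, l k with ht
  have ht0 : 0 ≤ t := Finset.sum_nonneg h0
  rcases le_total t 1 with h | h
  · have hterm : ∀ j ∈ S, l j * max 0 (1 - ∑ k ∈ S.erase j, l k) = l j * (1 - t) + l j ^ 2 :=
      fun j hj => by
        rw [he j hj, max_eq_right (by linarith [h0 j hj])]; ring
    rw [Finset.sum_congr rfl hterm, Finset.sum_add_distrib, ← Finset.sum_mul, ← ht,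
      max_eq_right (by linarith)]
    have := Finset.sum_sq_le_sq_sum_of_nonneg h0
    nlinarith
  · have htpos : 0 < t := by linarith
    have hterm : ∀ j ∈ S, l j * max 0 (1 - ∑ k ∈ S.erase j, l k) ≤ l j * (1 / t) := by
      intro j hj
      refine mul_le_mul_of_nonneg_left (max_le (by positivity) ?_) (h0 j hj)
      rw [he j hj, le_div_iff₀ htpos]
      nlinarith [h1 j hj, sq_nonneg (t - 1)]
    have := Finset.sum_le_sum hterm
    rw [← Finset.sum_mul, ← ht, mul_one_div_cancel htpos.ne'] at this
    rw [max_eq_left (by linarith)]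
    linarith

/-! ### Cuts refined at ties -/

section Cut

variable {n : ℕ}

/-- The value `x` of bidder `i` has priority over the value `y` of bidder `j`: its ironed virtual
value is higher, or equal and `i` comes first. -/
def Beats (F : Fin n → Measure ℝ) (i j : Fin n) (x y : ℝ) : Prop :=
  ironedVirtualValue (F j) y < ironedVirtualValue (F i) x ∨
    (ironedVirtualValue (F j) y = ironedVirtualValue (F i) x ∧ i < j)

/-- A threshold on ironed virtual values that is refined at ties: the weight `θ i` tells to what
extent bidder `i` passes with ironed virtual value exactly `T`. -/
structure IsCut (T : ℝ) (θ : Fin n → ℝ) : Prop where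
  nonneg : 0 ≤ T
  weight_nonneg : ∀ i, 0 ≤ θ i
  weight_le_one : ∀ i, θ i ≤ 1
  weight_eq_one : ∀ i j, i < j → 0 < θ j → θ i = 1

open Classical in
/-- The extent to which the value `x` of bidder `i` passes the cut `(T, θ)`. -/
noncomputable def cutWeight (F : Fin n → Measure ℝ) (T : ℝ) (θ : Fin n → ℝ) (i : Fin n) (x : ℝ) : ℝ :=
  if (T : EReal) < ironedVirtualValue (F i) x then 1
  else if (T : EReal) ≤ ironedVirtualValue (F i) x then θ i else 0

variable {F : Fin n → Measure ℝ}

lemma Beats.le {i j : Fin n} {x y : ℝ} (h : Beats F i j x y) :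
    ironedVirtualValue (F j) y ≤ ironedVirtualValue (F i) x :=
  h.elim le_of_lt fun h => h.1.le

lemma beats_or_beats {i j : Fin n} (hij : i ≠ j) (x y : ℝ) : Beats F i j x y ∨ Beats F j i y x := by
  rcases lt_trichotomy (ironedVirtualValue (F j) y) (ironedVirtualValue (F i) x) with h | h | h
  · exact Or.inl (Or.inl h)
  · rcases lt_or_gt_of_ne hij with hlt | hlt
    · exact Or.inl (Or.inr ⟨h, hlt⟩)
    · exact Or.inr (Or.inr ⟨h.symm, hlt⟩)
  · exact Or.inr (Or.inl h)

lemma Beats.asymm {i j : Fin n} {x y : ℝ} (h : Beats F i j x y) : ¬ Beats F j i y x := by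
  rintro (h' | ⟨h', hji⟩)
  · exact h'.not_ge h.le
  · rcases h with h | ⟨-, hij⟩
    · exact h.ne' h'
    · exact lt_asymm hij hji

/-- Ties go to i exactly when i precedes j, which decides between the weak and the strict upper set.
Nonnegativity makes the level a real number, so `toReal` is faithful. -/
lemma isVirtualUpperSet_beats {i j : Fin n} {y : ℝ} (hy : 0 ≤ ironedVirtualValue (F j) y) :
    IsVirtualUpperSet (F i) (ironedVirtualValue (F j) y).toReal {x | Beats F i j x y} := by
  have hcoe : ((ironedVirtualValue (F j) y).toReal : EReal) = ironedVirtualValue (F j) y :=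
    EReal.coe_toReal (ironedVirtualValue_lt_top y).ne (ne_bot_of_le_ne_bot EReal.zero_ne_bot hy)
  unfold IsVirtualUpperSet
  rw [hcoe]
  by_cases hij : i < j
  · left
    ext x
    simp [Beats, hij, le_iff_lt_or_eq]
  · right
    ext x
    simp [Beats, hij]

lemma cutWeight_nonneg {T : ℝ} {θ : Fin n → ℝ} (h : IsCut T θ) (i : Fin n) (x : ℝ) :
    0 ≤ cutWeight F T θ i x := by
  unfold cutWeight
  split_ifs
  exacts [zero_le_one, h.weight_nonneg i, le_rfl]

lemma cutWeight_le_one {T : ℝ} {θ : Fin n → ℝ} (h : IsCut T θ) (i : Fin n) (x : ℝ) :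
    cutWeight F T θ i x ≤ 1 := by
  unfold cutWeight
  split_ifs
  exacts [le_rfl, h.weight_le_one i, zero_le_one]

lemma le_of_cutWeight_pos {T : ℝ} {θ : Fin n → ℝ} {i : Fin n} {x : ℝ}
    (hx : 0 < cutWeight F T θ i x) : (T : EReal) ≤ ironedVirtualValue (F i) x := by
  unfold cutWeight at hx
  split_ifs at hx with h1 h2
  exacts [h1.le, h2, absurd hx (lt_irrefl _)]

/-- At a tie i precedes j, and `weight_eq_one` gives the earlier bidder full weight. So fractional
cuts behave like events: whoever beats a partly passing bidder passes fully. -/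
lemma Beats.cutWeight_eq_one {T : ℝ} {θ : Fin n → ℝ} (h : IsCut T θ) {i j : Fin n} {x y : ℝ}
    (hb : Beats F i j x y) (hy : 0 < cutWeight F T θ j y) : cutWeight F T θ i x = 1 := by
  have hT := le_of_cutWeight_pos hy
  rcases hb with hlt | ⟨heq, hij⟩
  · exact if_pos (hT.trans_lt hlt)
  · unfold cutWeight at hy ⊢
    rw [heq] at hy hT
    split_ifs at hy ⊢ with h1
    exacts [rfl, h.weight_eq_one i j hij hy]

variable [∀ i, IsProbabilityMeasure (F i)] (hnn : ∀ i, ∀ᵐ x ∂(F i), 0 ≤ x)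
  (ht : ∀ i, Tendsto (fun x : ℝ => x * (F i).real (Ici x)) atTop (𝓝 0))
include hnn ht

lemma measurable_ironedVirtualValue (i : Fin n) : Measurable (ironedVirtualValue (F i)) :=
  (monotone_ironedVirtualValue (hnn i) (ht i)).measurable

lemma measurableSet_lt_ironedVirtualValue (i : Fin n) (s : EReal) :
    MeasurableSet {x | s < ironedVirtualValue (F i) x} :=
  measurableSet_lt measurable_const (measurable_ironedVirtualValue hnn ht i)

lemma measurableSet_le_ironedVirtualValue (i : Fin n) (s : EReal) :
    MeasurableSet {x | s ≤ ironedVirtualValue (F i) x} :=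
  measurableSet_le measurable_const (measurable_ironedVirtualValue hnn ht i)

lemma measurable_cutWeight (T : ℝ) (θ : Fin n → ℝ) (i : Fin n) :
    Measurable (cutWeight F T θ i) :=
  Measurable.ite (measurableSet_lt_ironedVirtualValue hnn ht i T) measurable_const
    (Measurable.ite (measurableSet_le_ironedVirtualValue hnn ht i T) measurable_const
      measurable_const)

lemma integrable_cutWeight {T : ℝ} {θ : Fin n → ℝ} (h : IsCut T θ) (i : Fin n) :
    Integrable (cutWeight F T θ i) (F i) :=
  Integrable.of_bound (measurable_cutWeight hnn ht T θ i).aestronglyMeasurable 1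
    (Eventually.of_forall fun x => by
      rw [Real.norm_of_nonneg (cutWeight_nonneg h i x)]; exact cutWeight_le_one h i x)

lemma integral_cutWeight (T : ℝ) (θ : Fin n → ℝ) (i : Fin n) :
    ∫ x, cutWeight F T θ i x ∂(F i) =
      (1 - θ i) * (F i).real {x | (T : EReal) < ironedVirtualValue (F i) x} +
        θ i * (F i).real {x | (T : EReal) ≤ ironedVirtualValue (F i) x} := by
  have heq : cutWeight F T θ i = fun x =>
      {x | (T : EReal) < ironedVirtualValue (F i) x}.indicator (fun _ => 1 - θ i) x +
        {x | (T : EReal) ≤ ironedVirtualValue (F i) x}.indicator (fun _ => θ i) x := by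
    ext x
    by_cases h1 : (T : EReal) < ironedVirtualValue (F i) x
    · simp [cutWeight, h1, h1.le]
    · by_cases h2 : (T : EReal) ≤ ironedVirtualValue (F i) x <;> simp [cutWeight, h1, h2]
  have m1 := measurableSet_lt_ironedVirtualValue hnn ht i T
  have m2 := measurableSet_le_ironedVirtualValue hnn ht i T
  rw [heq, integral_add ((integrable_const _).indicator m1) ((integrable_const _).indicator m2),
    integral_indicator_const _ m1, integral_indicator_const _ m2]
  simp only [smul_eq_mul]
  ring

lemma integral_cutWeight_mem_Icc {T : ℝ} {θ : Fin n → ℝ} (h : IsCut T θ) (i : Fin n) :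
    ∫ x, cutWeight F T θ i x ∂(F i) ∈ Icc (0 : ℝ) 1 := by
  refine ⟨integral_nonneg (cutWeight_nonneg h i), ?_⟩
  have := integral_mono (integrable_cutWeight hnn ht h i) (integrable_const (1 : ℝ))
    (cutWeight_le_one h i)
  simpa using this

/-- The level of a cut supports the ironed revenue curves at the quantiles of the cut. -/
lemma ironedRevenue_le_cut {T : ℝ} {θ : Fin n → ℝ} (h : IsCut T θ) (i : Fin n) {y : ℝ}
    (hy : y ∈ Icc (0 : ℝ) 1) :
    ironedRevenue (F i) y ≤ ironedRevenue (F i) (∫ x, cutWeight F T θ i x ∂(F i)) +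
      T * (y - ∫ x, cutWeight F T θ i x ∂(F i)) := by
  rw [integral_cutWeight hnn ht]
  set q₁ := (F i).real {x | (T : EReal) < ironedVirtualValue (F i) x} with hq₁
  set q₂ := (F i).real {x | (T : EReal) ≤ ironedVirtualValue (F i) x} with hq₂
  have h1 := fun y hy => IsVirtualUpperSet.ironedRevenue_le_add (hnn i) (ht i)
    (Or.inr rfl : IsVirtualUpperSet (F i) T {x | (T : EReal) < ironedVirtualValue (F i) x})
    (y := y) hy
  have h2 := fun y hy => IsVirtualUpperSet.ironedRevenue_le_add (hnn i) (ht i)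
    (Or.inl rfl : IsVirtualUpperSet (F i) T {x | (T : EReal) ≤ ironedVirtualValue (F i) x})
    (y := y) hy
  simp only [← hq₁, ← hq₂] at h1 h2
  have m1 : q₁ ∈ Icc (0 : ℝ) 1 := measureReal_mem_Icc _
  have m2 : q₂ ∈ Icc (0 : ℝ) 1 := measureReal_mem_Icc _
  -- The cut quantile is a convex combination of q₁ and q₂. A line of slope T supports the curve at
  -- both, so the curve is affine between them.
  have hc := (concaveOn_ironedRevenue (hnn i) (ht i)).2 m1 m2
    (sub_nonneg.2 (h.weight_le_one i)) (h.weight_nonneg i) (by ring)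
  simp only [smul_eq_mul] at hc
  have e1 := h1 y hy
  have e2 := h2 q₁ m1
  have e3 := mul_le_mul_of_nonneg_left e2 (h.weight_nonneg i)
  linarith

end Cut

/-! ### Cuts of prescribed total rate -/

section ExistsCut

variable {n : ℕ} {F : Fin n → Measure ℝ} [∀ i, IsProbabilityMeasure (F i)]
  (hnn : ∀ i, ∀ᵐ x ∂(F i), 0 ≤ x)
  (ht : ∀ i, Tendsto (fun x : ℝ => x * (F i).real (Ici x)) atTop (𝓝 0))
include hnn ht

lemma tendsto_measureReal_le_ironedVirtualValue_of_monotone (i : Fin n) {u : ℕ → ℝ}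
    (hu : Monotone u) :
    Tendsto (fun k => (F i).real {x | (u k : EReal) ≤ ironedVirtualValue (F i) x}) atTop
      (𝓝 ((F i).real {x | ∀ k, (u k : EReal) ≤ ironedVirtualValue (F i) x})) := by
  have h := tendsto_measure_iInter_atTop (μ := F i)
    (s := fun k => {x | (u k : EReal) ≤ ironedVirtualValue (F i) x})
    (fun k => (measurableSet_le_ironedVirtualValue hnn ht i _).nullMeasurableSet)
    (fun k l hkl x hx => le_trans (EReal.coe_le_coe_iff.2 (hu hkl)) hx) ⟨0, measure_ne_top _ _⟩
  have heq : (⋂ k, {x | (u k : EReal) ≤ ironedVirtualValue (F i) x}) =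
      {x | ∀ k, (u k : EReal) ≤ ironedVirtualValue (F i) x} := by ext x; simp
  rw [heq] at h
  exact (ENNReal.tendsto_toReal (measure_ne_top _ _)).comp h

omit hnn ht in
lemma tendsto_measureReal_le_ironedVirtualValue_of_antitone (i : Fin n) {u : ℕ → ℝ}
    (hu : Antitone u) :
    Tendsto (fun k => (F i).real {x | (u k : EReal) ≤ ironedVirtualValue (F i) x}) atTop
      (𝓝 ((F i).real {x | ∃ k, (u k : EReal) ≤ ironedVirtualValue (F i) x})) := by
  have h := tendsto_measure_iUnion_atTop (μ := F i)
    (s := fun k => {x | (u k : EReal) ≤ ironedVirtualValue (F i) x})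
    (fun k l hkl x hx => le_trans (EReal.coe_le_coe_iff.2 (hu hkl)) hx)
  have heq : (⋃ k, {x | (u k : EReal) ≤ ironedVirtualValue (F i) x}) =
      {x | ∃ k, (u k : EReal) ≤ ironedVirtualValue (F i) x} := by ext x; simp
  rw [heq] at h
  exact (ENNReal.tendsto_toReal (measure_ne_top _ _)).comp h

/-- The level is the last one still reached at rate c. The rate is left-continuous in the level, and
tends to 0 because virtual values are below `⊤`. -/
lemma exists_cut_level {c : ℝ} (hc : 0 < c)
    (hcle : c ≤ ∑ i, (F i).real {x | 0 ≤ ironedVirtualValue (F i) x}) :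
    ∃ T : ℝ, 0 ≤ T ∧ ∑ i, (F i).real {x | (T : EReal) < ironedVirtualValue (F i) x} ≤ c ∧
      c ≤ ∑ i, (F i).real {x | (T : EReal) ≤ ironedVirtualValue (F i) x} := by
  set D : ℝ → ℝ := fun s => ∑ i, (F i).real {x | (s : EReal) ≤ ironedVirtualValue (F i) x} with hD
  have hDanti : Antitone D := fun s t hst => Finset.sum_le_sum fun i _ =>
    measureReal_mono fun x hx => le_trans (EReal.coe_le_coe_iff.2 hst) hx
  set S : Set ℝ := {s | 0 ≤ s ∧ c ≤ D s} with hS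
  have h0 : (0 : ℝ) ∈ S := ⟨le_rfl, by simpa [hD] using hcle⟩
  have hbdd : BddAbove S := by
    have hlim : Tendsto (fun k : ℕ => D k) atTop (𝓝 0) := by
      have := tendsto_finsetSum Finset.univ fun i (_ : i ∈ Finset.univ) =>
        tendsto_measureReal_le_ironedVirtualValue_of_monotone hnn ht i
          (u := fun k : ℕ => (k : ℝ)) Nat.mono_cast
      have hz : ∀ i, (F i).real {x | ∀ k : ℕ, ((k : ℝ) : EReal) ≤ ironedVirtualValue (F i) x} = 0 := by
        intro i
        convert measureReal_empty (μ := F i)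
        ext x
        simp only [mem_ofPred_eq, mem_empty_iff_false, iff_false, not_forall, not_le]
        obtain ⟨r, hr⟩ := EReal.lt_iff_exists_real_btwn.1 (ironedVirtualValue_lt_top (μ := F i) x)
        obtain ⟨k, hk⟩ := exists_nat_gt r
        exact ⟨k, hr.1.trans (EReal.coe_lt_coe_iff.2 hk)⟩
      simpa only [hz, Finset.sum_const_zero] using this
    obtain ⟨k, hk⟩ := (hlim.eventually_lt_const hc).exists
    refine ⟨k, fun s hs => le_of_not_gt fun hlt => ?_⟩
    exact (hs.2.trans (hDanti hlt.le)).not_gt hk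
  refine ⟨sSup S, le_csSup hbdd h0, ?_, ?_⟩
  · have hanti : Antitone fun k : ℕ => sSup S + 1 / ((k : ℝ) + 1) := fun k l hkl =>
      add_le_add_right (Nat.one_div_le_one_div hkl) _
    have hlim := tendsto_finsetSum Finset.univ fun i (_ : i ∈ Finset.univ) =>
      tendsto_measureReal_le_ironedVirtualValue_of_antitone (F := F) i hanti
    have hset : ∀ i, {x | ∃ k : ℕ, ((sSup S + 1 / ((k : ℝ) + 1) : ℝ) : EReal) ≤
        ironedVirtualValue (F i) x} = {x | ((sSup S : ℝ) : EReal) < ironedVirtualValue (F i) x} := by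
      intro i
      ext x
      constructor
      · rintro ⟨k, hk⟩
        exact lt_of_lt_of_le
          (EReal.coe_lt_coe_iff.2 (lt_add_of_pos_right _ Nat.one_div_pos_of_nat)) hk
      · intro hx
        obtain ⟨r, hr1, hr2⟩ := EReal.lt_iff_exists_real_btwn.1 hx
        obtain ⟨k, hk⟩ := exists_nat_one_div_lt (sub_pos.2 (EReal.coe_lt_coe_iff.1 hr1))
        exact ⟨k, le_trans (EReal.coe_le_coe_iff.2 (by linarith)) hr2.le⟩
    simp only [hset] at hlim
    refine le_of_tendsto' hlim fun k => ?_
    by_contra! hlt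
    have hmem : sSup S + 1 / ((k : ℝ) + 1) ∈ S :=
      ⟨add_nonneg (le_csSup hbdd h0) Nat.one_div_pos_of_nat.le, hlt.le⟩
    have := le_csSup hbdd hmem
    have h2 : 0 < 1 / ((k : ℝ) + 1) := Nat.one_div_pos_of_nat
    linarith
  · obtain ⟨u, hu, hulim, huS⟩ := exists_seq_tendsto_sSup ⟨0, h0⟩ hbdd
    have hlim := tendsto_finsetSum Finset.univ fun i (_ : i ∈ Finset.univ) =>
      tendsto_measureReal_le_ironedVirtualValue_of_monotone hnn ht i hu
    have hset : ∀ i, {x | ∀ k, (u k : EReal) ≤ ironedVirtualValue (F i) x} =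
        {x | ((sSup S : ℝ) : EReal) ≤ ironedVirtualValue (F i) x} := by
      intro i
      ext x
      refine ⟨fun hx => ?_, fun hx k => le_trans (EReal.coe_le_coe_iff.2 (le_csSup hbdd (huS k))) hx⟩
      exact le_of_tendsto' ((continuous_coe_real_ereal.tendsto _).comp hulim) hx
    simp only [hset] at hlim
    exact ge_of_tendsto' hlim fun k => (huS k).2

/-- There is a cut that the bidders pass at a prescribed total rate `c`. -/
lemma exists_isCut {c : ℝ} (hc : 0 < c)
    (hcle : c ≤ ∑ i, (F i).real {x | 0 ≤ ironedVirtualValue (F i) x}) :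
    ∃ T θ, IsCut T θ ∧ ∑ i, ∫ x, cutWeight F T θ i x ∂(F i) = c := by
  obtain ⟨T, hT0, hT1, hT2⟩ := exists_cut_level hnn ht hc hcle
  -- As t runs from 0 to n, the weights are switched on one after another in priority order, and the
  -- intermediate value theorem yields the rate c.
  set w : ℝ → Fin n → ℝ := fun t i => max 0 (min 1 (t - (i : ℕ))) with hw
  have hcont : Continuous fun t => ∑ i, ∫ x, cutWeight F T (w t) i x ∂(F i) := by
    simp only [integral_cutWeight hnn ht, hw]
    fun_prop
  have hmem : c ∈ Icc (∑ i, ∫ x, cutWeight F T (w 0) i x ∂(F i))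
      (∑ i, ∫ x, cutWeight F T (w n) i x ∂(F i)) := by
    have w0 : ∀ i, w 0 i = 0 := fun i => by simp [hw]
    have wn : ∀ i, w n i = 1 := fun i => by
      have : ((i : ℕ) : ℝ) + 1 ≤ n := by exact_mod_cast i.2
      simp only [hw]
      rw [min_eq_left (by linarith), max_eq_right zero_le_one]
    simp only [integral_cutWeight hnn ht, w0, wn]
    simpa using And.intro hT1 hT2
  obtain ⟨t, -, htc⟩ := intermediate_value_Icc (Nat.cast_nonneg n) hcont.continuousOn hmem
  refine ⟨T, w t, ⟨hT0, fun i => le_max_left _ _, fun i => max_le zero_le_one (min_le_left _ _),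
    fun i j hij hj => ?_⟩, htc⟩
  have h1 : ((i : ℕ) : ℝ) + 1 ≤ (j : ℕ) := by exact_mod_cast hij
  have h2 : 0 < min 1 (t - (j : ℕ)) := (lt_max_iff.1 hj).resolve_left (lt_irrefl _)
  have h3 := (lt_min_iff.1 h2).2
  simp only [hw]
  rw [min_eq_left (by linarith), max_eq_right zero_le_one]

end ExistsCut

/-! ### Winning bids and threshold payments -/

section Payment

variable {n : ℕ} {F : Fin n → Measure ℝ}

lemma myersonWins_one_iff {b : Fin n → ℝ} {i : Fin n} :
    MyersonWins F 1 b i ↔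
      0 ≤ ironedVirtualValue (F i) (b i) ∧ ∀ j, j ≠ i → Beats F i j (b i) (b j) := Iff.rfl

lemma MyersonWins.unique {b : Fin n → ℝ} {i j : Fin n} (hi : MyersonWins F 1 b i)
    (hj : MyersonWins F 1 b j) : i = j := by
  by_contra h
  exact ((myersonWins_one_iff.1 hi).2 j (Ne.symm h)).asymm ((myersonWins_one_iff.1 hj).2 i h)

/-- The bids with which bidder `i` wins against the bids `b` of the others. -/
def winningBids (F : Fin n → Measure ℝ) (b : Fin n → ℝ) (i : Fin n) : Set ℝ :=
  {t | MyersonWins F 1 (Function.update b i t) i}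

lemma mem_winningBids {b : Fin n → ℝ} {i : Fin n} {t : ℝ} : t ∈ winningBids F b i ↔
    0 ≤ ironedVirtualValue (F i) t ∧ ∀ j, j ≠ i → Beats F i j t (b j) := by
  unfold winningBids
  rw [mem_ofPred_eq, myersonWins_one_iff, Function.update_self]
  refine and_congr_right fun _ => forall₂_congr fun j hj => ?_
  rw [Function.update_of_ne hj]

lemma self_mem_winningBids {b : Fin n → ℝ} {i : Fin n} :
    b i ∈ winningBids F b i ↔ MyersonWins F 1 b i := by
  rw [mem_winningBids, myersonWins_one_iff]

lemma winningBids_update (b : Fin n → ℝ) (i : Fin n) (t : ℝ) :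
    winningBids F (Function.update b i t) i = winningBids F b i := by
  unfold winningBids
  simp only [Function.update_idem]

lemma myersonPayment_of_not {b : Fin n → ℝ} {i : Fin n} (h : ¬ MyersonWins F 1 b i) :
    myersonPayment F 1 b i = 0 := if_neg h

lemma IsVirtualUpperSet.inter {μ : Measure ℝ} {s t : ℝ} {V W : Set ℝ}
    (hV : IsVirtualUpperSet μ s V) (hW : IsVirtualUpperSet μ t W) :
    ∃ r, IsVirtualUpperSet μ r (V ∩ W) := by
  have key : ∀ {s t : ℝ} {V W : Set ℝ}, s < t → IsVirtualUpperSet μ s V →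
      IsVirtualUpperSet μ t W → W ⊆ V := by
    intro s t V W hst hV hW x hx
    have h1 : (t : EReal) ≤ ironedVirtualValue μ x := by
      rcases hW with rfl | rfl
      exacts [hx, le_of_lt hx]
    have h2 := (EReal.coe_lt_coe_iff.2 hst).trans_le h1
    rcases hV with rfl | rfl
    exacts [h2.le, h2]
  rcases lt_trichotomy s t with h | rfl | h
  · exact ⟨t, by rwa [inter_eq_self_of_subset_right (key h hV hW)]⟩
  · refine ⟨s, ?_⟩
    have hsub : {x | (s : EReal) < ironedVirtualValue μ x} ⊆
      {x | (s : EReal) ≤ ironedVirtualValue μ x} :=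
      fun x hx => le_of_lt (show (s : EReal) < _ from hx)
    rcases hV with rfl | rfl <;> rcases hW with rfl | rfl
    · exact Or.inl (inter_self _)
    · exact Or.inr (inter_eq_self_of_subset_right hsub)
    · exact Or.inr (inter_eq_self_of_subset_left hsub)
    · exact Or.inr (inter_self _)
  · exact ⟨s, by rwa [inter_eq_self_of_subset_left (key h hW hV)]⟩

lemma isVirtualUpperSet_zero (μ : Measure ℝ) :
    IsVirtualUpperSet μ 0 {x | 0 ≤ ironedVirtualValue μ x} := Or.inl (by simp)

/-- Each competitor and the reserve cut out an upper set, and such sets are nested. Thus the whole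
theory of thresholds applies to the payment. -/
lemma exists_isVirtualUpperSet_winningBids (b : Fin n → ℝ) (i : Fin n) :
    ∃ s, IsVirtualUpperSet (F i) s (winningBids F b i) := by
  have key : ∀ S : Finset (Fin n), ∃ s, IsVirtualUpperSet (F i) s
      {t | 0 ≤ ironedVirtualValue (F i) t ∧ ∀ j ∈ S, j ≠ i → Beats F i j t (b j)} := by
    intro S
    induction S using Finset.induction_on with
    | empty => exact ⟨0, by simpa using isVirtualUpperSet_zero (F i)⟩
    | insert k S _ ih =>
      obtain ⟨s, hs⟩ := ih
      by_cases hk : k ≠ i ∧ 0 ≤ ironedVirtualValue (F k) (b k)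
      · obtain ⟨r, hr⟩ := hs.inter (isVirtualUpperSet_beats (F := F) (i := i) hk.2)
        refine ⟨r, ?_⟩
        convert hr using 1
        ext t
        simp only [mem_ofPred_eq, mem_inter_iff, Finset.forall_mem_insert]
        exact ⟨fun h => ⟨⟨h.1, h.2.2⟩, h.2.1 hk.1⟩, fun h => ⟨h.1.1, fun _ => h.2, h.1.2⟩⟩
      -- A competitor with negative virtual value is beaten by every nonnegative one, so it adds no
      -- constraint.
      · refine ⟨s, ?_⟩
        convert hs using 1
        ext t
        simp only [mem_ofPred_eq, Finset.forall_mem_insert]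
        refine and_congr_right fun h0 => and_iff_right fun hki => Or.inl ?_
        exact (not_le.1 fun h => hk ⟨hki, h⟩).trans_le h0
  obtain ⟨s, hs⟩ := key Finset.univ
  refine ⟨s, ?_⟩
  convert hs using 1
  ext t
  simp [mem_winningBids]

variable [∀ i, IsProbabilityMeasure (F i)] (hnn : ∀ i, ∀ᵐ x ∂(F i), 0 ≤ x)
include hnn

lemma nonneg_of_mem_winningBids {b : Fin n → ℝ} {i : Fin n} {t : ℝ}
    (h : t ∈ winningBids F b i) : 0 ≤ t :=
  (isVirtualUpperSet_zero (F i)).nonneg_of_mem (hnn i) (mem_winningBids.1 h).1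

lemma myersonPayment_eq_sInf {b : Fin n → ℝ} {i : Fin n} (h : MyersonWins F 1 b i) :
    myersonPayment F 1 b i = sInf (winningBids F b i) := by
  refine (if_pos h).trans (congrArg sInf ?_)
  ext t
  exact ⟨fun ht => ht.2, fun ht => ⟨nonneg_of_mem_winningBids hnn ht, ht⟩⟩

lemma myersonPayment_nonneg (b : Fin n → ℝ) (i : Fin n) : 0 ≤ myersonPayment F 1 b i := by
  by_cases h : MyersonWins F 1 b i
  · rw [myersonPayment_eq_sInf hnn h]
    exact Real.sInf_nonneg fun t ht => nonneg_of_mem_winningBids hnn ht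
  · rw [myersonPayment_of_not h]

lemma sInf_le_myersonPayment {b : Fin n → ℝ} {i : Fin n} (h : MyersonWins F 1 b i) {s : ℝ}
    {W : Set ℝ} (hW : IsVirtualUpperSet (F i) s W) (hsub : winningBids F b i ⊆ W) :
    sInf W ≤ myersonPayment F 1 b i := by
  rw [myersonPayment_eq_sInf hnn h]
  exact csInf_le_csInf ⟨0, fun x hx => hW.nonneg_of_mem (hnn i) hx⟩
    ⟨_, self_mem_winningBids.2 h⟩ hsub

lemma reserve_le_myersonPayment {b : Fin n → ℝ} {i : Fin n} (h : MyersonWins F 1 b i) :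
    sInf {x | 0 ≤ ironedVirtualValue (F i) x} ≤ myersonPayment F 1 b i :=
  sInf_le_myersonPayment hnn h (isVirtualUpperSet_zero (F i)) fun _ ht => (mem_winningBids.1 ht).1

lemma sInf_beats_le_myersonPayment {b : Fin n → ℝ} {i j : Fin n} (h : MyersonWins F 1 b i)
    (hij : j ≠ i) (hj : 0 ≤ ironedVirtualValue (F j) (b j)) :
    sInf {x | Beats F i j x (b j)} ≤ myersonPayment F 1 b i :=
  sInf_le_myersonPayment hnn h (isVirtualUpperSet_beats hj) fun _ ht => (mem_winningBids.1 ht).2 j hij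

end Payment

/-! ### Upper bound by the ex-ante relaxation -/

lemma indicator_myersonWins_update {n : ℕ} {F : Fin n → Measure ℝ} (g : (Fin n → ℝ) → ℝ≥0∞)
    (b : Fin n → ℝ) (i : Fin n) (t : ℝ) :
    {b | MyersonWins F 1 b i}.indicator g (Function.update b i t) =
      (winningBids F b i).indicator (fun t => g (Function.update b i t)) t := by
  by_cases h : t ∈ winningBids F b i
  · rw [indicator_of_mem h, indicator_of_mem (show _ ∈ {b | MyersonWins F 1 b i} from h)]
  · rw [indicator_of_notMem h, indicator_of_notMem (show _ ∉ {b | MyersonWins F 1 b i} from h)]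

open Classical in
/-- The bound `C / m + T` on a payment made with probability `m`, infinite for `m = 0`. -/
noncomputable def paymentBound (C T m : ℝ≥0∞) : ℝ≥0∞ := (if m = 0 then ⊤ else C / m) + T

lemma measurable_paymentBound (C T : ℝ≥0∞) : Measurable (paymentBound C T) :=
  (Measurable.ite (measurableSet_singleton 0) measurable_const
    (measurable_const.div measurable_id)).add_const T

lemma paymentBound_mul_le (C T m : ℝ≥0∞) : paymentBound C T m * m ≤ C + T * m := by
  unfold paymentBound
  rw [add_mul]
  gcongr
  split_ifs with h
  -- Here `⊤ * 0 = 0`: an infinite bound costs nothing on a null set of winning bids.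
  · simp [h]
  · rw [mul_comm]
    exact ENNReal.mul_div_le

section Upper

variable {n : ℕ} {F : Fin n → Measure ℝ} [∀ i, IsProbabilityMeasure (F i)]
  (hnn : ∀ i, ∀ᵐ x ∂(F i), 0 ≤ x)
  (ht : ∀ i, Tendsto (fun x : ℝ => x * (F i).real (Ici x)) atTop (𝓝 0))
include hnn ht

lemma measurableSet_beats (i j : Fin n) : MeasurableSet {z : ℝ × ℝ | Beats F i j z.1 z.2} := by
  have hi : Measurable fun z : ℝ × ℝ => ironedVirtualValue (F i) z.1 :=
    (measurable_ironedVirtualValue hnn ht i).comp measurable_fst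
  have hj : Measurable fun z : ℝ × ℝ => ironedVirtualValue (F j) z.2 :=
    (measurable_ironedVirtualValue hnn ht j).comp measurable_snd
  exact (measurableSet_lt hj hi).union ((measurableSet_eq_fun hj hi).inter (MeasurableSet.const _))

lemma measurableSet_myersonWins (i : Fin n) : MeasurableSet {b | MyersonWins F 1 b i} := by
  have heq : {b | MyersonWins F 1 b i} = {b : Fin n → ℝ | 0 ≤ ironedVirtualValue (F i) (b i)} ∩
      ⋂ j, ⋂ (_ : j ≠ i), {b : Fin n → ℝ | Beats F i j (b i) (b j)} := by
    ext b
    simp [myersonWins_one_iff]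
  rw [heq]
  refine ((measurableSet_le_ironedVirtualValue hnn ht i 0).preimage (measurable_pi_apply i)).inter
    (MeasurableSet.iInter fun j => MeasurableSet.iInter fun _ => ?_)
  have h : Measurable fun b : Fin n → ℝ => (b i, b j) :=
    (measurable_pi_apply i).prodMk (measurable_pi_apply j)
  exact (measurableSet_beats hnn ht i j).preimage h

lemma measurableSet_winningBids (b : Fin n → ℝ) (i : Fin n) :
    MeasurableSet (winningBids F b i) :=
  (measurableSet_myersonWins hnn ht i).preimage (measurable_update b)

lemma measurable_measure_winningBids (i : Fin n) :
    Measurable fun b => F i (winningBids F b i) := by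
  have h := (measurable_const.indicator (measurableSet_myersonWins hnn ht i) :
    Measurable ({b | MyersonWins F 1 b i}.indicator fun _ => (1 : ℝ≥0∞))).lmarginal F (s := {i})
  rw [lmarginal_singleton] at h
  convert h using 2 with b
  simp only [indicator_myersonWins_update]
  rw [lintegral_indicator_const (measurableSet_winningBids hnn ht b i), one_mul]

/-- The payment of bidder `i`, bounded along a line of slope `T` and intercept `C` above her ironed
revenue curve. -/
lemma ofReal_myersonPayment_le {i : Fin n} {C T : ℝ} (hC : 0 ≤ C) (hT : 0 ≤ T)
    (hline : ∀ y ∈ Icc (0 : ℝ) 1, ironedRevenue (F i) y ≤ C + T * y) (b : Fin n → ℝ) :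
    ENNReal.ofReal (myersonPayment F 1 b i) ≤ {b | MyersonWins F 1 b i}.indicator
      (fun b => paymentBound (ENNReal.ofReal C) (ENNReal.ofReal T) (F i (winningBids F b i))) b := by
  by_cases hw : MyersonWins F 1 b i
  · rw [indicator_of_mem (show b ∈ {b | MyersonWins F 1 b i} from hw)]
    obtain ⟨s, hs⟩ := exists_isVirtualUpperSet_winningBids (F := F) b i
    have h1 := (hs.sInf_mul_le (hnn i) (ht i)).trans (hline _ (measureReal_mem_Icc _))
    rw [← myersonPayment_eq_sInf hnn hw] at h1
    unfold paymentBound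
    split_ifs with h0
    · simp
    · have hpos : 0 < (F i).real (winningBids F b i) := ENNReal.toReal_pos h0 (measure_ne_top _ _)
      have h2 : myersonPayment F 1 b i ≤ C / (F i).real (winningBids F b i) + T := by
        rw [← sub_le_iff_le_add, le_div_iff₀ hpos]
        linarith
      refine (ENNReal.ofReal_le_ofReal h2).trans ?_
      rw [ENNReal.ofReal_add (by positivity) hT, ENNReal.ofReal_div_of_pos hpos,
        ofReal_measureReal]
  · rw [myersonPayment_of_not hw]
    simp

lemma measurable_indicator_paymentBound (C T : ℝ≥0∞) (i : Fin n) :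
    Measurable ({b | MyersonWins F 1 b i}.indicator
      fun b => paymentBound C T (F i (winningBids F b i))) :=
  ((measurable_paymentBound C T).comp (measurable_measure_winningBids hnn ht i)).indicator
    (measurableSet_myersonWins hnn ht i)

/-- With the other bids fixed, m = `F i (winningBids F b i)` is constant and is the probability of
winning. Integrating the own bid alone gives (C / m + T) m, at most C + T m. -/
lemma lintegral_indicator_paymentBound_le (C T : ℝ≥0∞) (i : Fin n) :
    ∫⁻ b, {b | MyersonWins F 1 b i}.indicator
      (fun b => paymentBound C T (F i (winningBids F b i))) b ∂(Measure.pi F) ≤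
      C + T * Measure.pi F {b | MyersonWins F 1 b i} := by
  have hm := measurableSet_myersonWins hnn ht i
  have hmT : Measurable ({b | MyersonWins F 1 b i}.indicator fun _ => T) :=
    measurable_const.indicator hm
  calc _ ≤ ∫⁻ b, (C + {b | MyersonWins F 1 b i}.indicator (fun _ => T) b) ∂(Measure.pi F) := by
        refine lintegral_le_of_lmarginal_le {i} (measurable_indicator_paymentBound hnn ht C T i)
          (measurable_const.add hmT) ?_
        rw [lmarginal_singleton, lmarginal_singleton]
        intro b
        have hmb := measurableSet_winningBids hnn ht b i
        simp only [indicator_myersonWins_update, winningBids_update]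
        rw [lintegral_indicator_const hmb, lintegral_add_left measurable_const, lintegral_const,
          measure_univ, mul_one, lintegral_indicator_const hmb]
        exact paymentBound_mul_le C T _
    _ = _ := by
        rw [lintegral_add_left measurable_const, lintegral_const, measure_univ, mul_one,
          lintegral_indicator_const hm]

/-- The revenue on independent values is at most the ex-ante relaxation, bounded along lines of a
common slope `T` above the ironed revenue curves. -/
theorem lintegral_sum_myersonPayment_le {C : Fin n → ℝ} {T : ℝ} (hC : ∀ i, 0 ≤ C i) (hT : 0 ≤ T)
    (hline : ∀ i, ∀ y ∈ Icc (0 : ℝ) 1, ironedRevenue (F i) y ≤ C i + T * y) :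
    ∫⁻ b, ENNReal.ofReal (∑ i, myersonPayment F 1 b i) ∂(Measure.pi F) ≤
      ENNReal.ofReal (∑ i, C i + T) := by
  calc _ ≤ ∫⁻ b, ∑ i, {b | MyersonWins F 1 b i}.indicator (fun b => paymentBound
          (ENNReal.ofReal (C i)) (ENNReal.ofReal T) (F i (winningBids F b i))) b ∂(Measure.pi F) := by
        refine lintegral_mono fun b => ?_
        rw [ENNReal.ofReal_sum_of_nonneg fun i _ => myersonPayment_nonneg hnn b i]
        exact Finset.sum_le_sum fun i _ => ofReal_myersonPayment_le hnn ht (hC i) hT (hline i) b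
    _ ≤ ∑ i, (ENNReal.ofReal (C i) +
          ENNReal.ofReal T * Measure.pi F {b | MyersonWins F 1 b i}) := by
        rw [lintegral_finsetSum _ fun i _ => measurable_indicator_paymentBound hnn ht _ _ i]
        exact Finset.sum_le_sum fun i _ => lintegral_indicator_paymentBound_le hnn ht _ _ i
    _ ≤ _ := by
        have hdisj : ∑ i, Measure.pi F {b | MyersonWins F 1 b i} ≤ 1 := by
          rw [← measure_biUnion_finset (f := fun i => {b | MyersonWins F 1 b i})
            (fun i _ j _ hij => disjoint_left.2 fun b hi hj =>
              hij (MyersonWins.unique (show MyersonWins F 1 b i from hi) hj))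
            fun i _ => measurableSet_myersonWins hnn ht i]
          exact prob_le_one
        rw [Finset.sum_add_distrib, ← Finset.mul_sum,
          ENNReal.ofReal_add (Finset.sum_nonneg fun i _ => hC i) hT,
          ENNReal.ofReal_sum_of_nonneg fun i _ => hC i]
        gcongr
        exact mul_le_of_le_one_right' hdisj

end Upper

/-! ### Pointwise lower bound for payments -/

section Lower

variable {n : ℕ} {F : Fin n → Measure ℝ}

/-- The probability that bidder `i` passes the cut `(T, θ)`. -/
noncomputable def cutQuantile (F : Fin n → Measure ℝ) (T : ℝ) (θ : Fin n → ℝ) (i : Fin n) : ℝ :=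
  ∫ x, cutWeight F T θ i x ∂(F i)

/-- The extent to which the value `y` of bidder `j` passes the cut `(S, η)` but not `(T, θ)`. -/
noncomputable def excessWeight (F : Fin n → Measure ℝ) (T : ℝ) (θ : Fin n → ℝ) (S : ℝ)
    (η : Fin n → ℝ) (j : Fin n) (y : ℝ) : ℝ :=
  max 0 (cutWeight F S η j y - cutWeight F T θ j y)

/-- A lower bound for the payment that bidder `i` with value `x` makes because of the value `y` of
bidder `j` if the latter passes the cut `(S, η)` but not `(T, θ)`. -/
noncomputable def pairPayment (F : Fin n → Measure ℝ) (T : ℝ) (θ : Fin n → ℝ) (S : ℝ)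
    (η : Fin n → ℝ) (i j : Fin n) (z : ℝ × ℝ) : ℝ :=
  {z : ℝ × ℝ | Beats F i j z.1 z.2}.indicator (fun z => excessWeight F T θ S η j z.2 *
    (ironedRevenue (F i) (cutQuantile F T θ i) / (F i).real {x | Beats F i j x z.2})) z

variable {T S : ℝ} {θ η : Fin n → ℝ}

lemma excessWeight_nonneg (j : Fin n) (y : ℝ) : 0 ≤ excessWeight F T θ S η j y := le_max_left _ _

lemma excessWeight_le (hU : IsCut T θ) (hL : IsCut S η) (j : Fin n) (y : ℝ) :
    excessWeight F T θ S η j y ≤ cutWeight F S η j y :=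
  max_le (cutWeight_nonneg hL j y) (sub_le_self _ (cutWeight_nonneg hU j y))

lemma cutWeight_lt_of_excessWeight_pos {j : Fin n} {y : ℝ} (h : 0 < excessWeight F T θ S η j y) :
    cutWeight F T θ j y < cutWeight F S η j y :=
  sub_pos.1 ((lt_max_iff.1 h).resolve_left (lt_irrefl _))

lemma excessWeight_le_one (hU : IsCut T θ) (hL : IsCut S η) (j : Fin n) (y : ℝ) :
    excessWeight F T θ S η j y ≤ 1 :=
  (excessWeight_le hU hL j y).trans (cutWeight_le_one hL j y)

lemma nonneg_of_excessWeight_pos (hU : IsCut T θ) (hL : IsCut S η) {j : Fin n} {y : ℝ}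
    (h : 0 < excessWeight F T θ S η j y) :
    0 ≤ ironedVirtualValue (F j) y :=
  le_trans (by exact_mod_cast hL.nonneg)
    (le_of_cutWeight_pos (h.trans_le (excessWeight_le hU hL j y)))

variable [∀ i, IsProbabilityMeasure (F i)] (hnn : ∀ i, ∀ᵐ x ∂(F i), 0 ≤ x)
  (ht : ∀ i, Tendsto (fun x : ℝ => x * (F i).real (Ici x)) atTop (𝓝 0))
include hnn ht

lemma cutQuantile_mem_Icc (hU : IsCut T θ) (i : Fin n) : cutQuantile F T θ i ∈ Icc (0 : ℝ) 1 :=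
  integral_cutWeight_mem_Icc hnn ht hU i

lemma measurable_excessWeight (j : Fin n) : Measurable (excessWeight F T θ S η j) :=
  measurable_const.max ((measurable_cutWeight hnn ht S η j).sub (measurable_cutWeight hnn ht T θ j))

lemma measurableSet_beats_left (i j : Fin n) (y : ℝ) : MeasurableSet {x | Beats F i j x y} :=
  (measurableSet_beats hnn ht i j).preimage measurable_prodMk_right

variable (hU : IsCut T θ)
include hU

lemma ironedRevenue_cutQuantile_nonneg (i : Fin n) :
    0 ≤ ironedRevenue (F i) (cutQuantile F T θ i) :=
  ironedRevenue_nonneg (hnn i) (ht i) (cutQuantile_mem_Icc hnn ht hU i)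

/-- The threshold of W earns the ironed revenue at its quantile. A nonnegative slope supports the
curve there, so smaller quantiles earn no more. -/
lemma ironedRevenue_cutQuantile_le {i : Fin n} {s : ℝ} {W : Set ℝ} (hs : 0 ≤ s)
    (hW : IsVirtualUpperSet (F i) s W) (hle : cutQuantile F T θ i ≤ (F i).real W) :
    ironedRevenue (F i) (cutQuantile F T θ i) ≤ sInf W * (F i).real W := by
  rw [← hW.ironedRevenue_eq (hnn i) (ht i)]
  have := hW.ironedRevenue_le_add (hnn i) (ht i) (cutQuantile_mem_Icc hnn ht hU i)
  have := mul_nonpos_of_nonneg_of_nonpos hs (sub_nonpos.2 hle)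
  linarith

lemma pairPayment_nonneg (i j : Fin n) (z : ℝ × ℝ) : 0 ≤ pairPayment F T θ S η i j z :=
  indicator_nonneg (fun z _ => mul_nonneg (excessWeight_nonneg j z.2)
    (div_nonneg (ironedRevenue_cutQuantile_nonneg hnn ht hU i) measureReal_nonneg)) z

variable (hL : IsCut S η)
include hL

/-- Positive excess means that j does not fully pass (T, θ); hence every value of i that passes it,
even partly, beats y. -/
lemma cutQuantile_le_of_excessWeight_pos {i j : Fin n} (hij : j ≠ i) {y : ℝ}
    (h : 0 < excessWeight F T θ S η j y) :
    cutQuantile F T θ i ≤ (F i).real {x | Beats F i j x y} := by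
  have hm := measurableSet_beats_left hnn ht i j y
  have hlt := (cutWeight_lt_of_excessWeight_pos h).trans_le (cutWeight_le_one hL j y)
  have hle : ∀ x, cutWeight F T θ i x ≤ {x | Beats F i j x y}.indicator (fun _ => (1 : ℝ)) x := by
    intro x
    by_cases hb : Beats F i j x y
    · rw [indicator_of_mem (show x ∈ {x | Beats F i j x y} from hb)]
      exact cutWeight_le_one hU i x
    · rw [indicator_of_notMem (show x ∉ {x | Beats F i j x y} from hb)]
      by_contra! hpos
      have := ((beats_or_beats hij.symm x y).resolve_left hb).cutWeight_eq_one hU hpos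
      exact hlt.ne this
  calc cutQuantile F T θ i ≤ ∫ x, {x | Beats F i j x y}.indicator (fun _ => (1 : ℝ)) x ∂(F i) :=
        integral_mono (integrable_cutWeight hnn ht hU i) ((integrable_const _).indicator hm) hle
    _ = _ := by rw [integral_indicator_const _ hm, smul_eq_mul, mul_one]

lemma pairPayment_le_mul_payment {b : Fin n → ℝ} {i j : Fin n} (hij : j ≠ i)
    (hw : MyersonWins F 1 b i) :
    pairPayment F T θ S η i j (b i, b j) ≤ cutWeight F S η j (b j) * myersonPayment F 1 b i := by
  have hpay := myersonPayment_nonneg hnn b i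
  have hwt := cutWeight_nonneg (F := F) hL j (b j)
  have hb : Beats F i j (b i) (b j) := (myersonWins_one_iff.1 hw).2 j hij
  unfold pairPayment
  rw [indicator_of_mem (show (b i, b j) ∈ {z : ℝ × ℝ | Beats F i j z.1 z.2} from hb)]
  rcases (excessWeight_nonneg (F := F) (T := T) (S := S) (θ := θ) (η := η) j (b j)).eq_or_lt with h | h
  · simp only [← h, zero_mul]
    exact mul_nonneg hwt hpay
  · have h0 := nonneg_of_excessWeight_pos hU hL h
    have hW := isVirtualUpperSet_beats (F := F) (i := i) h0
    have h1 := ironedRevenue_cutQuantile_le hnn ht hU (EReal.toReal_nonneg h0) hW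
      (cutQuantile_le_of_excessWeight_pos hnn ht hU hL hij h)
    have h2 := sInf_beats_le_myersonPayment hnn hw hij h0
    have h3 : 0 ≤ sInf {x | Beats F i j x (b j)} :=
      Real.sInf_nonneg fun x hx => hW.nonneg_of_mem (hnn i) hx
    refine mul_le_mul (excessWeight_le hU hL j _) ((div_le_of_le_mul₀ measureReal_nonneg h3 h1).trans
      h2) (div_nonneg (ironedRevenue_cutQuantile_nonneg hnn ht hU i) measureReal_nonneg) hwt

/-- The exclusion factors are left untruncated, so that they stay affine and the expansion involves
at most three values per term. For a winner, pair terms are at most `cutWeight` of j times the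
payment, and `sum_mul_exclusion_le_one` adds them up. For a loser, each term is nonpositive. -/
lemma sum_pairPayment_le_myersonPayment (b : Fin n → ℝ) (i : Fin n) :
    ∑ j ∈ Finset.univ.erase i, pairPayment F T θ S η i j (b i, b j) *
        (1 - ∑ k ∈ (Finset.univ.erase i).erase j, cutWeight F S η k (b k)) +
      cutWeight F S η i (b i) * sInf {x | 0 ≤ ironedVirtualValue (F i) x} *
        (1 - ∑ k ∈ Finset.univ.erase i, cutWeight F S η k (b k)) ≤ myersonPayment F 1 b i := by
  set l : Fin n → ℝ := fun k => cutWeight F S η k (b k) with hl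
  have l0 : ∀ k, 0 ≤ l k := fun k => cutWeight_nonneg hL k _
  have l1 : ∀ k, l k ≤ 1 := fun k => cutWeight_le_one hL k _
  set π := myersonPayment F 1 b i with hπ
  have hπ0 : 0 ≤ π := myersonPayment_nonneg hnn b i
  have hρ0 : 0 ≤ sInf {x | 0 ≤ ironedVirtualValue (F i) x} :=
    Real.sInf_nonneg fun x hx => (isVirtualUpperSet_zero (F i)).nonneg_of_mem (hnn i) hx
  by_cases hw : MyersonWins F 1 b i
  · have key := sum_mul_exclusion_le_one (Finset.univ.erase i) l (fun k _ => l0 k) fun k _ => l1 k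
    have hpair : ∀ j ∈ Finset.univ.erase i, pairPayment F T θ S η i j (b i, b j) *
        (1 - ∑ k ∈ (Finset.univ.erase i).erase j, l k) ≤
        π * (l j * max 0 (1 - ∑ k ∈ (Finset.univ.erase i).erase j, l k)) := by
      intro j hj
      have h1 := pairPayment_le_mul_payment hnn ht hU hL (Finset.ne_of_mem_erase hj) hw
      calc _ ≤ pairPayment F T θ S η i j (b i, b j) *
            max 0 (1 - ∑ k ∈ (Finset.univ.erase i).erase j, l k) :=
          mul_le_mul_of_nonneg_left (le_max_right _ _) (pairPayment_nonneg hnn ht hU i j _)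
        _ ≤ l j * π * max 0 (1 - ∑ k ∈ (Finset.univ.erase i).erase j, l k) :=
          mul_le_mul_of_nonneg_right h1 (le_max_left _ _)
        _ = _ := by ring
    have hself : l i * sInf {x | 0 ≤ ironedVirtualValue (F i) x} *
        (1 - ∑ k ∈ Finset.univ.erase i, l k) ≤ π * max 0 (1 - ∑ k ∈ Finset.univ.erase i, l k) := by
      have h1 : l i * sInf {x | 0 ≤ ironedVirtualValue (F i) x} ≤ π :=
        (mul_le_of_le_one_left hρ0 (l1 i)).trans (reserve_le_myersonPayment hnn hw)
      exact (mul_le_mul_of_nonneg_left (le_max_right _ _) (mul_nonneg (l0 i) hρ0)).trans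
        (mul_le_mul_of_nonneg_right h1 (le_max_left _ _))
    calc _ ≤ ∑ j ∈ Finset.univ.erase i,
          π * (l j * max 0 (1 - ∑ k ∈ (Finset.univ.erase i).erase j, l k)) +
          π * max 0 (1 - ∑ k ∈ Finset.univ.erase i, l k) :=
          add_le_add (Finset.sum_le_sum hpair) hself
      _ = π * (∑ j ∈ Finset.univ.erase i, l j * max 0 (1 - ∑ k ∈ (Finset.univ.erase i).erase j, l k) +
          max 0 (1 - ∑ k ∈ Finset.univ.erase i, l k)) := by rw [mul_add, Finset.mul_sum]
      _ ≤ π * 1 := mul_le_mul_of_nonneg_left key hπ0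
      _ = π := mul_one π
  -- A loser that passes (S, η) even partly is beaten by some k, and this k passes fully, which
  -- makes the exclusion factor nonpositive.
  · have hblock : 0 < l i → ∃ k, k ≠ i ∧ Beats F k i (b k) (b i) ∧ l k = 1 := by
      intro hi
      have h0 : 0 ≤ ironedVirtualValue (F i) (b i) :=
        le_trans (by exact_mod_cast hL.nonneg) (le_of_cutWeight_pos hi)
      rw [myersonWins_one_iff] at hw
      push Not at hw
      obtain ⟨k, hk, hb⟩ := hw h0
      have hb' := (beats_or_beats hk (b k) (b i)).resolve_right hb
      exact ⟨k, hk, hb', hb'.cutWeight_eq_one hL hi⟩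
    rw [hπ, myersonPayment_of_not hw]
    refine add_nonpos (Finset.sum_nonpos fun j hj => ?_) ?_
    · by_cases hpos : Beats F i j (b i) (b j) ∧ 0 < excessWeight F T θ S η j (b j)
      · have hlj : 0 < l j := hpos.2.trans_le (excessWeight_le hU hL j _)
        have hli : l i = 1 := hpos.1.cutWeight_eq_one hL hlj
        obtain ⟨k, hk, hb, hlk⟩ := hblock (hli ▸ one_pos)
        -- The factor omits j, so the blocking bidder must be a third one: k beats i, whereas i
        -- beats j.
        have hkj : k ≠ j := by
          rintro rfl
          exact hb.asymm hpos.1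
        have hsum := Finset.single_le_sum (f := l) (fun k _ => l0 k)
          (Finset.mem_erase.2 ⟨hkj, Finset.mem_erase.2 ⟨hk, Finset.mem_univ k⟩⟩)
        exact mul_nonpos_of_nonneg_of_nonpos (pairPayment_nonneg hnn ht hU i j _) (by linarith)
      · have hz : pairPayment F T θ S η i j (b i, b j) = 0 := by
          unfold pairPayment
          by_cases hb : Beats F i j (b i) (b j)
          · rw [indicator_of_mem (show (b i, b j) ∈ {z : ℝ × ℝ | Beats F i j z.1 z.2} from hb),
              le_antisymm (not_lt.1 fun h => hpos ⟨hb, h⟩) (excessWeight_nonneg j (b j)), zero_mul]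
          · exact indicator_of_notMem (show (b i, b j) ∉ {z : ℝ × ℝ | Beats F i j z.1 z.2} from hb) _
        rw [hz, zero_mul]
    · rcases (l0 i).eq_or_lt with h | h
      · rw [show cutWeight F S η i (b i) = 0 from h.symm, zero_mul, zero_mul]
      · obtain ⟨k, hk, -, hlk⟩ := hblock h
        have hsum := Finset.single_le_sum (f := l) (fun k _ => l0 k)
          (Finset.mem_erase.2 ⟨hk, Finset.mem_univ k⟩)
        exact mul_nonpos_of_nonneg_of_nonpos (mul_nonneg h.le hρ0) (by linarith)

end Lower

/-! ### Expectations under a 3-wise independent prior -/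

/-- Since the factor is affine, f need only be independent of each single `g k`, with no joint
independence of the `g k`. -/
lemma integral_mul_one_sub_sum {Ω ι : Type*} [MeasurableSpace Ω] {P : Measure Ω}
    {f : Ω → ℝ} {g : ι → Ω → ℝ} (K : Finset ι) (hf : Integrable f P)
    (hg : ∀ k ∈ K, Integrable (g k) P) (hind : ∀ k ∈ K, IndepFun f (g k) P) :
    Integrable (fun ω => f ω * (1 - ∑ k ∈ K, g k ω)) P ∧
      ∫ ω, f ω * (1 - ∑ k ∈ K, g k ω) ∂P = (∫ ω, f ω ∂P) * (1 - ∑ k ∈ K, ∫ ω, g k ω ∂P) := by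
  have heq : (fun ω => f ω * (1 - ∑ k ∈ K, g k ω)) = fun ω => f ω - ∑ k ∈ K, f ω * g k ω := by
    ext ω
    rw [mul_sub, mul_one, Finset.mul_sum]
  have hint : ∀ k ∈ K, Integrable (fun ω => f ω * g k ω) P := fun k hk =>
    (hind k hk).integrable_mul hf (hg k hk)
  have hsum := integrable_finsetSum K hint
  refine ⟨heq ▸ hf.sub hsum, ?_⟩
  rw [heq, integral_sub hf hsum, integral_finsetSum K hint, mul_sub, mul_one, Finset.mul_sum]
  congr 1
  exact Finset.sum_congr rfl fun k hk => (hind k hk).integral_fun_mul_eq_mul_integral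
    hf.aestronglyMeasurable (hg k hk).aestronglyMeasurable

lemma ofReal_integral_le_lintegral_ofReal {Ω : Type*} [MeasurableSpace Ω] {P : Measure Ω}
    {f : Ω → ℝ} (hf : Integrable f P) :
    ENNReal.ofReal (∫ ω, f ω ∂P) ≤ ∫⁻ ω, ENNReal.ofReal (f ω) ∂P := by
  rw [integral_eq_lintegral_pos_part_sub_lintegral_neg_part hf]
  refine (ENNReal.ofReal_le_ofReal (sub_le_self _ ENNReal.toReal_nonneg)).trans
    ENNReal.ofReal_toReal_le

section Expectation

variable {n : ℕ} {F : Fin n → Measure ℝ} {P : Measure (Fin n → ℝ)}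

lemma IsKWiseIndependentPrior.indepFun_pair (hP : IsKWiseIndependentPrior 3 F P) {i j : Fin n}
    (hij : i ≠ j) : IndepFun (fun v : Fin n → ℝ => v i) (fun v => v j) P :=
  (hP.iIndepFun {i, j} (Finset.card_le_two.trans (by norm_num))).indepFun
    (i := ⟨i, by simp⟩) (j := ⟨j, by simp⟩) (by simpa using hij)

lemma IsKWiseIndependentPrior.indepFun_triple (hP : IsKWiseIndependentPrior 3 F P) {i j k : Fin n}
    (hik : i ≠ k) (hjk : j ≠ k) :
    IndepFun (fun v : Fin n → ℝ => (v i, v j)) (fun v => v k) P :=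
  (hP.iIndepFun {i, j, k} Finset.card_le_three).indepFun_prodMk
    (fun i => measurable_pi_apply (i : Fin n)) ⟨i, by simp⟩ ⟨j, by simp⟩ ⟨k, by simp⟩
    (by simpa using hik) (by simpa using hjk)

variable {T S : ℝ} {θ η : Fin n → ℝ}
variable [∀ i, IsProbabilityMeasure (F i)] (hnn : ∀ i, ∀ᵐ x ∂(F i), 0 ≤ x)
  (ht : ∀ i, Tendsto (fun x : ℝ => x * (F i).real (Ici x)) atTop (𝓝 0))
include hnn ht

lemma integrable_excessWeight (hU : IsCut T θ) (hL : IsCut S η) (j : Fin n) :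
    Integrable (excessWeight F T θ S η j) (F j) :=
  Integrable.of_bound (measurable_excessWeight hnn ht j).aestronglyMeasurable 1
    (Eventually.of_forall fun y => by
      rw [Real.norm_of_nonneg (excessWeight_nonneg j y)]; exact excessWeight_le_one hU hL j y)

lemma sub_le_integral_excessWeight (hU : IsCut T θ) (hL : IsCut S η) (j : Fin n) :
    cutQuantile F S η j - cutQuantile F T θ j ≤ ∫ y, excessWeight F T θ S η j y ∂(F j) := by
  unfold cutQuantile
  rw [← integral_sub (integrable_cutWeight hnn ht hL j) (integrable_cutWeight hnn ht hU j)]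
  exact integral_mono ((integrable_cutWeight hnn ht hL j).sub (integrable_cutWeight hnn ht hU j))
    (integrable_excessWeight hnn ht hU hL j) fun y => le_max_right _ _

lemma measurable_measure_beats (i j : Fin n) :
    Measurable fun y => (F i).real {x | Beats F i j x y} :=
  (measurable_measure_prodMk_right (μ := F i) (measurableSet_beats hnn ht i j)).ennreal_toReal

lemma measurable_pairPayment (i j : Fin n) : Measurable (pairPayment F T θ S η i j) := by
  refine Measurable.indicator ?_ (measurableSet_beats hnn ht i j)
  exact ((measurable_excessWeight hnn ht j).comp measurable_snd).mul
    (measurable_const.div ((measurable_measure_beats hnn ht i j).comp measurable_snd))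

variable (hU : IsCut T θ) (hL : IsCut S η)
include hU hL

lemma pairPayment_le {i j : Fin n} (hij : j ≠ i) (z : ℝ × ℝ) :
    pairPayment F T θ S η i j z ≤
      ironedRevenue (F i) (cutQuantile F T θ i) / cutQuantile F T θ i := by
  have hR := ironedRevenue_cutQuantile_nonneg hnn ht hU i
  have ha := (cutQuantile_mem_Icc hnn ht hU i).1
  have hb := div_nonneg hR ha
  by_cases hz : Beats F i j z.1 z.2
  · unfold pairPayment
    rw [indicator_of_mem (show z ∈ {z : ℝ × ℝ | Beats F i j z.1 z.2} from hz)]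
    rcases (excessWeight_nonneg (F := F) (T := T) (S := S) (θ := θ) (η := η) j z.2).eq_or_lt
      with h | h
    · rw [← h, zero_mul]
      exact hb
    · have hle := cutQuantile_le_of_excessWeight_pos hnn ht hU hL hij h
      refine (mul_le_of_le_one_left (div_nonneg hR measureReal_nonneg)
        (excessWeight_le_one hU hL j _)).trans ?_
      -- At quantile 0 the ironed revenue is 0, so both quotients vanish.
      rcases ha.eq_or_lt with h0 | h0
      · rw [← h0, ironedRevenue_zero (hnn i) (ht i), zero_div, zero_div]
      · exact div_le_div_of_nonneg_left hR h0 hle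
  · unfold pairPayment
    rwa [indicator_of_notMem (show z ∉ {z : ℝ × ℝ | Beats F i j z.1 z.2} from hz)]

lemma norm_pairPayment_le {i j : Fin n} (hij : j ≠ i) (z : ℝ × ℝ) :
    ‖pairPayment F T θ S η i j z‖ ≤
      ironedRevenue (F i) (cutQuantile F T θ i) / cutQuantile F T θ i := by
  rw [Real.norm_of_nonneg (pairPayment_nonneg hnn ht hU i j z)]
  exact pairPayment_le hnn ht hU hL hij z

/-- The division by the probability of beating y in `pairPayment` cancels against the integral over
the own value, so only the excess weight still depends on y. -/
lemma integral_pairPayment_left {i j : Fin n} (hij : j ≠ i) (y : ℝ) :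
    ∫ x, pairPayment F T θ S η i j (x, y) ∂(F i) =
      ironedRevenue (F i) (cutQuantile F T θ i) * excessWeight F T θ S η j y := by
  have hm := measurableSet_beats_left hnn ht i j y
  have heq : (fun x => pairPayment F T θ S η i j (x, y)) = {x | Beats F i j x y}.indicator
      fun _ => excessWeight F T θ S η j y *
        (ironedRevenue (F i) (cutQuantile F T θ i) / (F i).real {x | Beats F i j x y}) := rfl
  rw [heq, integral_indicator_const _ hm, smul_eq_mul]
  rcases (excessWeight_nonneg (F := F) (T := T) (S := S) (θ := θ) (η := η) j y).eq_or_lt with h | h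
  · simp [← h]
  · have hle := cutQuantile_le_of_excessWeight_pos hnn ht hU hL hij h
    rcases (measureReal_nonneg (μ := F i) (s := {x | Beats F i j x y})).eq_or_lt with h0 | h0
    · have : cutQuantile F T θ i = 0 :=
        le_antisymm (hle.trans_eq h0.symm) (cutQuantile_mem_Icc hnn ht hU i).1
      rw [this, ironedRevenue_zero (hnn i) (ht i)]
      simp
    · field_simp

lemma integral_pairPayment (hP : IsKWiseIndependentPrior 3 F P) {i j : Fin n} (hij : j ≠ i) :
    ∫ v, pairPayment F T θ S η i j (v i, v j) ∂P =
      ironedRevenue (F i) (cutQuantile F T θ i) * ∫ y, excessWeight F T θ S η j y ∂(F j) := by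
  have := hP.isProbabilityMeasure
  have hmeas := measurable_pairPayment (T := T) (S := S) (θ := θ) (η := η) hnn ht i j
  have hpair : Measurable fun v : Fin n → ℝ => (v i, v j) :=
    (measurable_pi_apply i).prodMk (measurable_pi_apply j)
  have hlaw : P.map (fun v : Fin n → ℝ => (v i, v j)) = (F i).prod (F j) := by
    rw [(indepFun_iff_map_prod_eq_prod_map_map (measurable_pi_apply i).aemeasurable
      (measurable_pi_apply j).aemeasurable).1 (hP.indepFun_pair hij.symm), hP.map_eval, hP.map_eval]
  rw [← integral_map (φ := fun v : Fin n → ℝ => (v i, v j)) hpair.aemeasurable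
    hmeas.aestronglyMeasurable, hlaw, integral_prod_symm _ (Integrable.of_bound
    hmeas.aestronglyMeasurable _ (Eventually.of_forall (norm_pairPayment_le hnn ht hU hL hij)))]
  simp only [integral_pairPayment_left hnn ht hU hL hij]
  rw [integral_const_mul]

/-- The revenue on a 3-wise independent prior, bounded below by the payments of bidders that are
alone to pass the cut `(S, η)`, or pass it together with a single competitor. -/
theorem le_lintegral_sum_myersonPayment (hP : IsKWiseIndependentPrior 3 F P) :
    ENNReal.ofReal ((1 - ∑ k, cutQuantile F S η k) *
      ∑ i, (ironedRevenue (F i) (cutQuantile F T θ i) *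
          ∑ j ∈ Finset.univ.erase i, ∫ y, excessWeight F T θ S η j y ∂(F j) +
        cutQuantile F S η i * sInf {x | 0 ≤ ironedVirtualValue (F i) x})) ≤
      ∫⁻ v, ENNReal.ofReal (∑ i, myersonPayment F 1 v i) ∂P := by
  have := hP.isProbabilityMeasure
  set ρ : Fin n → ℝ := fun i => sInf {x | 0 ≤ ironedVirtualValue (F i) x} with hρ
  have hρ0 : ∀ i, 0 ≤ ρ i := fun i =>
    Real.sInf_nonneg fun x hx => (isVirtualUpperSet_zero (F i)).nonneg_of_mem (hnn i) hx
  set l : Fin n → (Fin n → ℝ) → ℝ := fun k v => cutWeight F S η k (v k) with hl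
  have hlmeas : ∀ k, Measurable (l k) := fun k =>
    (measurable_cutWeight hnn ht S η k).comp (measurable_pi_apply k)
  have hlint : ∀ k, Integrable (l k) P := fun k =>
    Integrable.of_bound (hlmeas k).aestronglyMeasurable 1 (Eventually.of_forall fun v => by
      rw [Real.norm_of_nonneg (cutWeight_nonneg hL k _)]; exact cutWeight_le_one hL k _)
  have hlE : ∀ k, ∫ v, l k v ∂P = cutQuantile F S η k := by
    intro k
    rw [cutQuantile, ← hP.map_eval k, integral_map (measurable_pi_apply k).aemeasurable]
    rw [hP.map_eval]
    exact (measurable_cutWeight hnn ht S η k).aestronglyMeasurable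
  have hq0 : ∀ k, 0 ≤ cutQuantile F S η k := fun k => (cutQuantile_mem_Icc hnn ht hL k).1
  have hpmeas : ∀ i j, Measurable fun v : Fin n → ℝ => pairPayment F T θ S η i j (v i, v j) :=
    fun i j => (measurable_pairPayment hnn ht i j).comp
      ((measurable_pi_apply i).prodMk (measurable_pi_apply j))
  have hpair : ∀ i, ∀ j ∈ Finset.univ.erase i, _ := fun i j hj => integral_mul_one_sub_sum (P := P)
    (f := fun v => pairPayment F T θ S η i j (v i, v j)) (g := l) ((Finset.univ.erase i).erase j)
    (Integrable.of_bound (hpmeas i j).aestronglyMeasurable _ (Eventually.of_forall fun v =>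
      norm_pairPayment_le hnn ht hU hL (Finset.ne_of_mem_erase hj) _))
    (fun k _ => hlint k) fun k hk => by
      have h1 := Finset.ne_of_mem_erase hk
      have h2 := Finset.ne_of_mem_erase (Finset.mem_of_mem_erase hk)
      exact (hP.indepFun_triple h2.symm h1.symm).comp (measurable_pairPayment hnn ht i j)
        (measurable_cutWeight hnn ht S η k)
  have hself : ∀ i, _ := fun i => integral_mul_one_sub_sum (P := P)
    (f := fun v => l i v * ρ i) (g := l) (Finset.univ.erase i) ((hlint i).mul_const _)
    (fun k _ => hlint k) fun k hk =>
      (hP.indepFun_pair (Finset.ne_of_mem_erase hk).symm).comp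
        ((measurable_cutWeight hnn ht S η i).mul_const (ρ i)) (measurable_cutWeight hnn ht S η k)
  have hi1 : ∀ i, Integrable (fun v => ∑ j ∈ Finset.univ.erase i,
      pairPayment F T θ S η i j (v i, v j) * (1 - ∑ k ∈ (Finset.univ.erase i).erase j, l k v)) P :=
    fun i => integrable_finsetSum _ fun j hj => (hpair i j hj).1
  have hi2 : ∀ i, Integrable (fun v => ∑ j ∈ Finset.univ.erase i,
      pairPayment F T θ S η i j (v i, v j) * (1 - ∑ k ∈ (Finset.univ.erase i).erase j, l k v) +
      l i v * ρ i * (1 - ∑ k ∈ Finset.univ.erase i, l k v)) P := fun i => (hi1 i).add (hself i).1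
  have hi3 := integrable_finsetSum Finset.univ fun i (_ : i ∈ Finset.univ) => hi2 i
  calc _ ≤ ENNReal.ofReal (∫ v, ∑ i, (∑ j ∈ Finset.univ.erase i,
          pairPayment F T θ S η i j (v i, v j) *
            (1 - ∑ k ∈ (Finset.univ.erase i).erase j, l k v) +
          l i v * ρ i * (1 - ∑ k ∈ Finset.univ.erase i, l k v)) ∂P) := by
        refine ENNReal.ofReal_le_ofReal ?_
        rw [integral_finsetSum _ fun i _ => hi2 i, Finset.mul_sum]
        refine Finset.sum_le_sum fun i _ => ?_
        rw [integral_add (hi1 i) (hself i).1, integral_finsetSum _ fun j hj => (hpair i j hj).1,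
          mul_add, Finset.mul_sum, Finset.mul_sum]
        refine add_le_add (Finset.sum_le_sum fun j hj => ?_) ?_
        · rw [(hpair i j hj).2, integral_pairPayment hnn ht hU hL hP (Finset.ne_of_mem_erase hj),
            mul_comm]
          simp only [hlE]
          -- Putting the omitted bidders i and j back into the exclusion sum only lowers the factor
          -- and makes it common to all terms.
          refine mul_le_mul_of_nonneg_left (sub_le_sub_left (Finset.sum_le_sum_of_subset_of_nonneg
            (Finset.subset_univ _) fun k _ _ => hq0 k) _) (mul_nonneg
            (ironedRevenue_cutQuantile_nonneg hnn ht hU i)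
            (integral_nonneg fun y => excessWeight_nonneg j y))
        · rw [(hself i).2, integral_mul_const, mul_comm]
          simp only [hlE]
          exact mul_le_mul_of_nonneg_left (sub_le_sub_left (Finset.sum_le_sum_of_subset_of_nonneg
            (Finset.subset_univ _) fun k _ _ => hq0 k) _) (mul_nonneg (hq0 i) (hρ0 i))
    _ ≤ ∫⁻ v, ENNReal.ofReal (∑ i, (∑ j ∈ Finset.univ.erase i,
          pairPayment F T θ S η i j (v i, v j) *
            (1 - ∑ k ∈ (Finset.univ.erase i).erase j, l k v) +
          l i v * ρ i * (1 - ∑ k ∈ Finset.univ.erase i, l k v))) ∂P :=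
        ofReal_integral_le_lintegral_ofReal hi3
    _ ≤ _ := lintegral_mono fun v => ENNReal.ofReal_le_ofReal (Finset.sum_le_sum fun i _ =>
        sum_pairPayment_le_myersonPayment hnn ht hU hL v i)

end Expectation

/-! ### Comparison of the two bounds -/

section Robust

variable {n : ℕ} {F : Fin n → Measure ℝ}

lemma myersonRevenue_pure (σ : Equiv.Perm (Fin n)) (P : Measure (Fin n → ℝ)) :
    myersonRevenue F (PMF.pure σ) P = ∫⁻ v, ENNReal.ofReal (∑ i, myersonPayment F σ v i) ∂P := by
  unfold myersonRevenue
  rw [Finset.sum_eq_single σ (fun τ _ hτ => by simp [PMF.pure_apply, hτ]) (by simp)]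
  simp [PMF.pure_apply]

variable [∀ i, IsProbabilityMeasure (F i)] (hnn : ∀ i, ∀ᵐ x ∂(F i), 0 ≤ x)
  (ht : ∀ i, Tendsto (fun x : ℝ => x * (F i).real (Ici x)) atTop (𝓝 0))
include hnn ht

lemma mul_cutQuantile_le {T : ℝ} {θ : Fin n → ℝ} (hU : IsCut T θ) (i : Fin n) :
    T * cutQuantile F T θ i ≤ ironedRevenue (F i) (cutQuantile F T θ i) := by
  have := ironedRevenue_le_cut hnn ht hU i (y := 0) (by simp)
  rw [ironedRevenue_zero (hnn i) (ht i)] at this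
  unfold cutQuantile
  linarith

lemma lintegral_sum_myersonPayment_le_cut {T : ℝ} {θ : Fin n → ℝ} (hU : IsCut T θ) :
    ∫⁻ b, ENNReal.ofReal (∑ i, myersonPayment F 1 b i) ∂(Measure.pi F) ≤
      ENNReal.ofReal (∑ i, ironedRevenue (F i) (cutQuantile F T θ i) +
        T * (1 - ∑ i, cutQuantile F T θ i)) := by
  refine (lintegral_sum_myersonPayment_le hnn ht (T := T) (C := fun i =>
    ironedRevenue (F i) (cutQuantile F T θ i) - T * cutQuantile F T θ i)
    (fun i => sub_nonneg.2 (mul_cutQuantile_le hnn ht hU i)) hU.nonneg fun i y hy => ?_).trans_eq ?_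
  · have := ironedRevenue_le_cut hnn ht hU i hy
    unfold cutQuantile
    linarith
  · rw [Finset.sum_sub_distrib, ← Finset.mul_sum]
    congr 1
    ring

lemma robust_of_le_sum {P : Measure (Fin n → ℝ)} (hP : IsKWiseIndependentPrior 3 F P)
    (hX : 2 / 3 ≤ ∑ i, (F i).real {x | 0 ≤ ironedVirtualValue (F i) x}) :
    ∫⁻ v, ENNReal.ofReal (∑ i, myersonPayment F 1 v i) ∂(Measure.pi F) ≤
      64 * ∫⁻ v, ENNReal.ofReal (∑ i, myersonPayment F 1 v i) ∂P := by
  obtain ⟨T, θ, hU, hUc⟩ := exists_isCut hnn ht (c := 1 / 3) (by norm_num) (by linarith)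
  obtain ⟨S, η, hL, hLc⟩ := exists_isCut hnn ht (c := 2 / 3) (by norm_num) hX
  change ∑ i, cutQuantile F T θ i = 1 / 3 at hUc
  change ∑ i, cutQuantile F S η i = 2 / 3 at hLc
  set R : Fin n → ℝ := fun i => ironedRevenue (F i) (cutQuantile F T θ i) with hR
  have hR0 : ∀ i, 0 ≤ R i := ironedRevenue_cutQuantile_nonneg hnn ht hU
  have hup := lintegral_sum_myersonPayment_le_cut hnn ht hU
  have hlow := le_lintegral_sum_myersonPayment hnn ht hU hL hP
  rw [hUc] at hup
  rw [hLc] at hlow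
  have hTR : T * (1 / 3) ≤ ∑ i, R i := by
    rw [← hUc, Finset.mul_sum]
    exact Finset.sum_le_sum fun i _ => mul_cutQuantile_le hnn ht hU i
  -- If i carries much of the rate of the lax cut, its competitors have little excess. The missing
  -- share `cutQuantile F S η i` is supplied by the reserve term, since the reserve price is at
  -- least `R i`.
  have hterm : ∀ i, R i * (1 / 3) ≤ R i * ∑ j ∈ Finset.univ.erase i,
      ∫ y, excessWeight F T θ S η j y ∂(F j) +
        cutQuantile F S η i * sInf {x | 0 ≤ ironedVirtualValue (F i) x} := by
    intro i
    have hW := isVirtualUpperSet_zero (F i)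
    have hρ0 : 0 ≤ sInf {x | 0 ≤ ironedVirtualValue (F i) x} :=
      Real.sInf_nonneg fun x hx => hW.nonneg_of_mem (hnn i) hx
    -- Slope 0 supports the curve at the quantile of the reserve, so its maximum is the reserve
    -- price times a probability.
    have hρ : R i ≤ sInf {x | 0 ≤ ironedVirtualValue (F i) x} := by
      have h1 := hW.ironedRevenue_le (hnn i) (ht i) (cutQuantile_mem_Icc hnn ht hU i)
      have h2 := mul_le_of_le_one_right hρ0
        (measureReal_le_one (μ := F i) (s := {x | 0 ≤ ironedVirtualValue (F i) x}))
      simp only [hR]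
      linarith
    have hq0 := (cutQuantile_mem_Icc hnn ht hL i).1
    have hsum : 1 / 3 ≤ ∑ j ∈ Finset.univ.erase i, ∫ y, excessWeight F T θ S η j y ∂(F j) +
        cutQuantile F S η i := by
      have h1 := Finset.sum_le_sum fun j (_ : j ∈ Finset.univ.erase i) =>
        sub_le_integral_excessWeight hnn ht hU hL j
      rw [Finset.sum_sub_distrib] at h1
      have h2 := Finset.sum_erase_add Finset.univ (cutQuantile F S η) (Finset.mem_univ i)
      have h3 := Finset.sum_erase_add Finset.univ (cutQuantile F T θ) (Finset.mem_univ i)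
      have h4 := (cutQuantile_mem_Icc hnn ht hU i).1
      linarith
    have := mul_le_mul_of_nonneg_left hsum (hR0 i)
    have := mul_le_mul_of_nonneg_left hρ hq0
    linarith
  have hall := Finset.sum_le_sum fun i (_ : i ∈ Finset.univ) => hterm i
  rw [← Finset.sum_mul] at hall
  have hRsum : 0 ≤ ∑ i, R i := Finset.sum_nonneg fun i _ => hR0 i
  refine hup.trans (le_trans ?_ (mul_le_mul_right hlow 64))
  rw [← ENNReal.ofReal_ofNat 64, ← ENNReal.ofReal_mul (by norm_num)]
  refine ENNReal.ofReal_le_ofReal ?_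
  -- With A = ∑ R i: T ≤ 3 A bounds the revenue on the product prior by A + (2/3) T ≤ 3 A, while the
  -- lower bound is (1/3)(1/3) A. The ratio is 27.
  linarith

/-- At level 0 the term T (1 - ∑ q_i) disappears, and both cuts coincide, so no excess remains. The
reserve terms are exactly the ironed revenues, with a factor above 1/3 for exclusion. -/
lemma robust_of_sum_lt {P : Measure (Fin n → ℝ)} (hP : IsKWiseIndependentPrior 3 F P)
    (hX : ∑ i, (F i).real {x | 0 ≤ ironedVirtualValue (F i) x} < 2 / 3) :
    ∫⁻ v, ENNReal.ofReal (∑ i, myersonPayment F 1 v i) ∂(Measure.pi F) ≤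
      64 * ∫⁻ v, ENNReal.ofReal (∑ i, myersonPayment F 1 v i) ∂P := by
  have hU : IsCut (n := n) 0 fun _ => 1 :=
    ⟨le_rfl, fun _ => zero_le_one, fun _ => le_rfl, fun _ _ _ _ => rfl⟩
  have hq : ∀ i, cutQuantile F 0 (fun _ => 1) i =
      (F i).real {x | 0 ≤ ironedVirtualValue (F i) x} := by
    intro i
    rw [cutQuantile, integral_cutWeight hnn ht]
    simp
  have hup := lintegral_sum_myersonPayment_le_cut hnn ht hU
  have hlow := le_lintegral_sum_myersonPayment hnn ht hU hU hP
  have hexc : ∀ j, ∫ y, excessWeight F 0 (fun _ => 1) 0 (fun _ => 1) j y ∂(F j) = 0 := by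
    intro j
    simp [excessWeight]
  have hR : ∀ i, cutQuantile F 0 (fun _ => 1) i * sInf {x | 0 ≤ ironedVirtualValue (F i) x} =
      ironedRevenue (F i) (cutQuantile F 0 (fun _ => 1) i) := by
    intro i
    rw [hq, (isVirtualUpperSet_zero (F i)).ironedRevenue_eq (hnn i) (ht i), mul_comm]
  simp only [hexc, Finset.sum_const_zero, mul_zero, zero_add, hR] at hlow
  simp only [zero_mul, add_zero] at hup
  have hR0 := Finset.sum_nonneg fun i (_ : i ∈ Finset.univ) =>
    ironedRevenue_cutQuantile_nonneg hnn ht hU i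
  simp only [← hq] at hX
  refine hup.trans (le_trans ?_ (mul_le_mul_right hlow 64))
  rw [← ENNReal.ofReal_ofNat 64, ← ENNReal.ofReal_mul (by norm_num)]
  refine ENNReal.ofReal_le_ofReal ?_
  have := mul_le_mul_of_nonneg_right (show 1 / 3 ≤ 1 - ∑ k, cutQuantile F 0 (fun _ => 1) k by
    linarith) hR0
  linarith

end Robust

theorem mainTheorem2 {n : ℕ} (F : Fin n → Measure ℝ) (hprob : ∀ i, IsProbabilityMeasure (F i))
    (hnonneg : ∀ i, ∀ᵐ x ∂(F i), 0 ≤ x)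
    (htail : ∀ i, Tendsto (fun x : ℝ => x * (F i).real (Ici x)) atTop (𝓝 0)) :
    ∃ w : PMF (Equiv.Perm (Fin n)), IsKWiseRobust 3 64 F (myersonRevenue F w) := by
  refine ⟨PMF.pure 1, fun P hP => ?_⟩
  rw [myersonRevenue_pure, myersonRevenue_pure]
  rcases le_or_gt (2 / 3) (∑ i, (F i).real {x | 0 ≤ ironedVirtualValue (F i) x}) with h | h
  · exact robust_of_le_sum hnonneg htail hP h
  · exact robust_of_sum_lt hnonneg htail hP h
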